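/- \textbf{Theorem (Efficient pure free-fermionic testing).} Let $n\ge 1$. On $n$ qubits let $\gamma_{2k-1}=(\prod_{j<k}Z_j)X_k$ and $\gamma_{2k}=(\prod_{j<k}Z_j)Y_k$, $k\in[n]$, be the Majorana operators, and let the correlation matrix of a state $\rho$ be the $2n\times 2n$ matrix $\Gamma(\rho)_{\mu\nu}=-\tfrac{i}{2}\operatorname{Tr}([\gamma_\mu,\gamma_\nu]\rho)$. A unitary $U$ is free-fermionic if, for some real orthogonal $2n\times 2n$ matrix $Q$, $U^\dagger\gamma_\mu U=\sum_\nu Q_{\mu\nu}\gamma_\nu$ for all $\mu$. Let $\mathcal G_{\mathrm{mixed}}$ be the set of free-fermionic states $U\bigl(\bigotimes_{j=1}^n\frac{I+\lambda_jZ_j}{2}\bigr)U^\dagger$ with $U$ a free-fermionic unitary and $\lambda_j\in[-1,1]$, and let $\mathcal G_{\mathrm{pure}}$ be the set of those of rank one. Let $\|\cdot\|_1$ be the trace norm and $\|\cdot\|_\infty$ the operator norm. Let $\varepsilon_A,\varepsilon_B\in(0,1)$ with $\varepsilon_B>2\sqrt{n\varepsilon_A}$, let $\delta\in(0,1]$,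 let $0<\varepsilon_{\mathrm{stat}}<\frac12\bigl(\frac{\varepsilon_B^2}{2n}-2\varepsilon_A\bigr)$, and put $$N=\Bigl\lceil 8\,\frac{n^3}{\varepsilon_{\mathrm{stat}}^2}\log\frac{4n^2}{\delta}\Bigr\rceil,\qquad \varepsilon_{\mathrm T}=\frac12\Bigl(\frac{\varepsilon_B^2}{2n}+2\varepsilon_A\Bigr).$$ Then there are $N$ measurements, each acting on a single copy of an $n$-qubit state and all fixed in advance, and a rule that computes from their outcomes a real anti-symmetric $2n\times 2n$ matrix $\hat\Gamma$ (measurements and rule do not depend on the unknown state), such that: 1. For every $n$-qubit state $\rho$, when each of $N$ copies of $\rho$ is measured by the corresponding measurement, $\|\hat\Gamma-\Gamma(\rho)\|_\infty\le\varepsilon_{\mathrm{stat}}$ with probability at least $1-\delta$. 2. Consider the test that outputs ``A'' if the smallest singular value of $\hat\Gamma$ is at least $1-\varepsilon_{\mathrm T}$ (equivalently, all non-negative normal eigenvalues of $\hat\Gamma$ are at least $1-\varepsilon_{\mathrm T}$, where the normal eigenvalues are the $\hat\lambda_k$ for which $\hat\Gamma$ has eigenvalues $\pm i\hat\lambda_k$,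 $k\in[n]$), and ``B'' otherwise. Let $\rho$ be an $n$-qubit state and let $\mathcal G\in\{\mathcal G_{\mathrm{mixed}},\mathcal G_{\mathrm{pure}}\}$; assume that $\rho$ is pure or that $\mathcal G=\mathcal G_{\mathrm{pure}}$. If $\|\rho-\sigma\|_1\le\varepsilon_A$ for some $\sigma\in\mathcal G$ (Case A), then the test outputs ``A'' with probability at least $1-\delta$. If $\|\rho-\sigma\|_1>\varepsilon_B$ for all $\sigma\in\mathcal G$ (Case B), then the test outputs ``B'' with probability at least $1-\delta$. -/

import Mathlib

open scoped ComplexOrder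

namespace FreeFermion

noncomputable section

/-- The computational basis of `n` qubits is indexed by bit strings. -/
abbrev Basis (n : ℕ) : Type := Fin n → Fin 2

/-- Operators on the Hilbert space of `n` qubits, as `2 ^ n × 2 ^ n` complex matrices. -/
abbrev Op (n : ℕ) : Type := Matrix (Basis n) (Basis n) ℂ

/-- Labels of the `2 n` Majorana operators: `(k, 0)` is the first and `(k, 1)` the second Majorana
operator of mode `k`, i.e. numbers `2 k - 1` and `2 k` when modes are counted from one. -/
abbrev Label (n : ℕ) : Type := Fin n × Fin 2

/-! ### Schatten norms -/

/-- The Schatten 1-norm: the sum of the singular values, with multiplicity. -/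
def traceNorm {ι : Type} [Fintype ι] [DecidableEq ι] (A : Matrix ι ι ℂ) : ℝ :=
  ∑ i ∈ Finset.range (Fintype.card ι), (Matrix.toEuclideanLin A).singularValues i

/-- The Schatten ∞-norm: the operator norm with respect to the Euclidean norm. -/
def opNorm {ι : Type} [Fintype ι] [DecidableEq ι] (A : Matrix ι ι ℂ) : ℝ :=
  ‖Matrix.toEuclideanCLM (n := ι) (𝕜 := ℂ) A‖

/-- The smallest singular value of a square real matrix (Mathlib lists the singular values in
decreasing order, starting with number zero). For an anti-symmetric matrix the singular values
are the absolute values of the normal eigenvalues, each occurring twice. -/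
def minSingularValue {ι : Type} [Fintype ι] [DecidableEq ι] (A : Matrix ι ι ℝ) : ℝ :=
  (Matrix.toEuclideanLin A).singularValues (Fintype.card ι - 1)

/-! ### States and Majorana operators -/

/-- `ρ` is a quantum state (density matrix). -/
def IsState {n : ℕ} (ρ : Op n) : Prop := ρ.PosSemidef ∧ ρ.trace = 1

/-- `ρ` is a pure quantum state: a state of rank one. -/
def IsPure {n : ℕ} (ρ : Op n) : Prop := IsState ρ ∧ ρ.rank = 1

def pauliX : Matrix (Fin 2) (Fin 2) ℂ := !![0, 1; 1, 0]

def pauliY : Matrix (Fin 2) (Fin 2) ℂ := !![0, -Complex.I; Complex.I, 0]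

def pauliZ : Matrix (Fin 2) (Fin 2) ℂ := !![1, 0; 0, -1]

/-- The tensor (Kronecker) product of `n` single-qubit operators. -/
def tensor {n : ℕ} (A : Fin n → Matrix (Fin 2) (Fin 2) ℂ) : Op n :=
  Matrix.of fun x y => ∏ j, A j (x j) (y j)

/-- The Majorana operators `Z ⊗ ⋯ ⊗ Z ⊗ X ⊗ I ⊗ ⋯ ⊗ I` and `Z ⊗ ⋯ ⊗ Z ⊗ Y ⊗ I ⊗ ⋯ ⊗ I`, where
`X`, respectively `Y`, acts on qubit `k`. -/
def majorana {n : ℕ} (μ : Label n) : Op n :=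
  tensor fun j =>
    if j < μ.1 then pauliZ
    else if j = μ.1 then (if μ.2 = 0 then pauliX else pauliY)
    else 1

/-- The correlation matrix `Γ(ρ)_{μν} = -(i/2) Tr([γ_μ, γ_ν] ρ)`. -/
def correlationMatrix {n : ℕ} (ρ : Op n) : Matrix (Label n) (Label n) ℂ :=
  Matrix.of fun μ ν =>
    -(Complex.I / 2) *
      ((majorana μ * majorana ν - majorana ν * majorana μ) * ρ).trace

/-! ### Free-fermionic states -/

/-- `U` is a free-fermionic unitary: a unitary such that, for some real orthogonal matrix `Q`,
`U† γ_μ U = ∑_ν Q_{μν} γ_ν` for all `μ`. -/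
def IsFreeFermionicUnitary {n : ℕ} (U : Op n) : Prop :=
  U ∈ Matrix.unitaryGroup (Basis n) ℂ ∧
    ∃ Q ∈ Matrix.orthogonalGroup (Label n) ℝ,
      ∀ μ, U.conjTranspose * majorana μ * U = ∑ ν, (Q μ ν : ℂ) • majorana ν

/-- The product state `⨂_j (I + l_j Z_j) / 2`. -/
def diagonalProductState {n : ℕ} (l : Fin n → ℝ) : Op n :=
  tensor fun j => (1 / 2 : ℂ) • (1 + (l j : ℂ) • pauliZ)

/-- The set of all (possibly mixed) free-fermionic states. -/
def freeMixed (n : ℕ) : Set (Op n) :=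
  {σ | ∃ (U : Op n) (l : Fin n → ℝ), IsFreeFermionicUnitary U ∧
    (∀ j, l j ∈ Set.Icc (-1 : ℝ) 1) ∧
    σ = U * diagonalProductState l * U.conjTranspose}

/-- The set of pure free-fermionic states. -/
def freePure (n : ℕ) : Set (Op n) := {σ | σ ∈ freeMixed n ∧ IsPure σ}

/-! ### The testing problem -/

/-- Case A: `ρ` is `ε`-close in trace norm to some member of `𝒢`. -/
def CaseA {n : ℕ} (𝒢 : Set (Op n)) (ε : ℝ) (ρ : Op n) : Prop :=
  ∃ σ ∈ 𝒢, traceNorm (ρ - σ) ≤ ε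

/-- Case B: `ρ` is `ε`-far in trace norm from all members of `𝒢`. -/
def CaseB {n : ℕ} (𝒢 : Set (Op n)) (ε : ℝ) (ρ : Op n) : Prop :=
  ∀ σ ∈ 𝒢, ε < traceNorm (ρ - σ)

/-- The possible outputs of a tester. -/
inductive Verdict : Type
  | A : Verdict
  | B : Verdict

/-! ### Single-copy measurements and the test -/

/-- A measurement on one copy of an `n`-qubit state, with `K` possible outcomes (a POVM). -/
structure Measurement (n K : ℕ) where
  effect : Fin K → Op n
  posSemidef : ∀ a, (effect a).PosSemidef
  sum_eq_one : ∑ a, effect a = 1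

/-- Born's rule: the probability of the outcome `a` on the state `ρ`. -/
def Measurement.outcomeProb {n K : ℕ} (M : Measurement n K) (ρ : Op n) (a : Fin K) : ℝ :=
  (M.effect a * ρ).trace.re

/-- A procedure that estimates the correlation matrix from `N` copies of an `n`-qubit state: copy
number `m` is measured on its own, by a measurement `measurement m` fixed in advance, and a real
anti-symmetric matrix is computed from the `N` outcomes. -/
structure CorrelationEstimator (n N K : ℕ) where
  measurement : Fin N → Measurement n K
  estimate : (Fin N → Fin K) → Matrix (Label n) (Label n) ℝ
  antisymm : ∀ x, (estimate x).transpose = -estimate x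

/-- The probability that the list of outcomes lies in `E` when the procedure is run on `N` copies
of `ρ`; the outcomes on different copies are independent. -/
def CorrelationEstimator.prob {n N K : ℕ} (alg : CorrelationEstimator n N K) (ρ : Op n)
    (E : Set (Fin N → Fin K)) : ℝ :=
  ∑ x, E.indicator (fun x => ∏ m, (alg.measurement m).outcomeProb ρ (x m)) x

open Classical in
/-- The test: answer `A` if the smallest singular value of the estimated correlation matrix (that
is, each of its non-negative normal eigenvalues) is at least `1 - εT`, and `B` otherwise. -/
def CorrelationEstimator.verdict {n N K : ℕ} (alg : CorrelationEstimator n N K) (εT : ℝ)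
    (x : Fin N → Fin K) : Verdict :=
  if 1 - εT ≤ minSingularValue (alg.estimate x) then Verdict.A else Verdict.B

/-- The number of copies `⌈8 (n³ / εstat²) log (4 n² / δ)⌉`. -/
def numCopies (n : ℕ) (εstat δ : ℝ) : ℕ :=
  ⌈8 * ((n : ℝ) ^ 3 / εstat ^ 2) * Real.log (4 * (n : ℝ) ^ 2 / δ)⌉₊

/-- The threshold `εT = (εB² / (2 n) + 2 εA) / 2`. -/
def threshold (n : ℕ) (εA εB : ℝ) : ℝ :=
  1 / 2 * (εB ^ 2 / (2 * (n : ℝ)) + 2 * εA)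

end

end FreeFermion

/-! The singular values of the correlation matrix `Γ` control the distance to the free-fermionic
states from both sides.

Near a free-fermionic state they are large. A real combination of Majorana operators with unit
coefficient vector is unitary, so `Γ` is a contraction from trace norm to operator norm
(`realCorrelation_mulVec_sq_le`). A free-fermionic unitary acts on `Γ` by an orthogonal conjugation,
so a free-fermionic `σ` has singular values `|λ_k|`. If `ρ` or `σ` is pure and `‖ρ - σ‖₁ ≤ ε`, then
`|λ_k| ≥ 1 - ε`, because the overlap of a pure state with `σ` is at most the largest eigenvalue of
`σ` (`one_sub_traceNorm_le_abs`). Hence `Γ(ρ)` has no singular value below `1 - 2ε`.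

Conversely, let all singular values of `Γ(ρ)` be at least `1 - x`, where `x < 1` and `n x < 2`. The
normal form of an anti-symmetric matrix supplies an orthonormal frame of pairs with correlations at
least `1 - x` (`exists_orthonormal_pairs`), and a free-fermionic unitary makes this frame standard
(`exists_freeFermionicUnitary`, via generation of the orthogonal group by reflections). There every
`Z_k` has expectation at least `1 - x`; a union bound gives fidelity at least `1 - n x / 2` with the
all-zero state, and Fuchs–van de Graaf turns this into squared trace distance at most `2 n x`.

For the estimate, the pairs of Majorana labels split into `2n - 1` perfect matchings. The `n`
correlations of one matching are read off together from a computational-basis measurement in a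
rotated frame. Hoeffding and a union bound over `n (2n - 1)` pairs control the entries, and the
double multiplicity of singular values of an anti-symmetric matrix saves a factor two in passing to
the operator norm.

The threshold is the midpoint between `2 εA` and `εB² / (2n)`, and `εstat` is less than half the
gap, so one accurate estimate settles both cases. -/

namespace FreeFermion

open Matrix

/-! ### Singular values, trace norm and operator norm -/

section MatrixFacts

variable {ι : Type} [Fintype ι] [DecidableEq ι]

/-- Having `S'` as a variable, tied to `S` only through its form, lets `toEuclideanLin (Aᴴ * A)`, by
which matrix eigenvalues are defined, replace the adjoint composite without rewriting inside a
dependent term. -/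
lemma singularValues_eq_sqrt_eigenvalues {𝕜 E : Type*} [RCLike 𝕜] [NormedAddCommGroup E]
    [InnerProductSpace 𝕜 E] [FiniteDimensional 𝕜 E] {S S' : E →ₗ[𝕜] E}
    (h : ∀ v w, inner 𝕜 (S v) (S w) = inner 𝕜 (S' v) w) (hS' : S'.IsSymmetric) {k : ℕ}
    (hk : Module.finrank 𝕜 E = k) (i : Fin k) :
    S.singularValues i = √(hS'.eigenvalues hk i) := by
  obtain rfl : LinearMap.adjoint S ∘ₗ S = S' := by
    ext v
    exact ext_inner_right 𝕜 fun w => by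
      rw [LinearMap.comp_apply, LinearMap.adjoint_inner_left, h]
  rw [LinearMap.singularValues_fin _ hk]

lemma singularValues_toEuclideanLin {𝕜 : Type*} [RCLike 𝕜] (A : Matrix ι ι 𝕜)
    (i : Fin (Fintype.card ι)) :
    (toEuclideanLin A).singularValues i =
      √((isHermitian_conjTranspose_mul_self A).eigenvalues₀ i) := by
  refine singularValues_eq_sqrt_eigenvalues (S' := toEuclideanLin (Aᴴ * A)) (fun v w => ?_) _ _ i
  simp only [EuclideanSpace.inner_eq_star_dotProduct, toLpLin_apply, star_mulVec,
    conjTranspose_mul, conjTranspose_conjTranspose]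
  rw [dotProduct_comm, dotProduct_mulVec, vecMul_vecMul, dotProduct_comm]

lemma traceNorm_eq_sum_sqrt_eigenvalues (A : Matrix ι ι ℂ) :
    traceNorm A = ∑ i, √((isHermitian_conjTranspose_mul_self A).eigenvalues i) := by
  rw [traceNorm, Finset.sum_range]
  simp only [singularValues_toEuclideanLin]
  exact (Equiv.sum_comp (Fintype.equivOfCardEq (Fintype.card_fin _)).symm
    (fun i => √((isHermitian_conjTranspose_mul_self A).eigenvalues₀ i))).symm

/-- Here `Aᴴ * A` is the square of `A`, so its eigenvalues are the squares up to order. The order is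
avoided by comparing root multisets of the characteristic polynomial and summing `√` over them. -/
lemma traceNorm_eq_sum_abs_eigenvalues {A : Matrix ι ι ℂ} (hA : A.IsHermitian) :
    traceNorm A = ∑ i, |hA.eigenvalues i| := by
  rw [traceNorm_eq_sum_sqrt_eigenvalues]
  have hB := isHermitian_conjTranspose_mul_self A
  have h2 : cfc (fun x : ℝ => x ^ 2) A = Aᴴ * A := by
    rw [cfc_pow_id (R := ℝ) A 2 hA.isSelfAdjoint, hA.eq, pow_two]
  have h3 := hA.charpoly_cfc_eq (fun x => x ^ 2)
  rw [h2] at h3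
  have h4 := hB.roots_charpoly_eq_eigenvalues
  rw [h3, Polynomial.roots_prod _ _
    (Finset.prod_ne_zero_iff.mpr fun i _ => Polynomial.X_sub_C_ne_zero _)] at h4
  have h5 := congrArg (fun s => (s.map fun z : ℂ => √z.re).sum) h4
  simp only [Polynomial.roots_X_sub_C, Multiset.bind_singleton, Multiset.map_map] at h5
  have h6 : ∑ i, √(hA.eigenvalues i ^ 2) = ∑ i, √(hB.eigenvalues i) := by
    exact h5
  rw [← h6]
  simp [Real.sqrt_sq_eq_abs]

lemma hermitian_eq_mul_diagonal_mul {A : Matrix ι ι ℂ} (hA : A.IsHermitian) :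
    A = (hA.eigenvectorUnitary : Matrix ι ι ℂ) *
      diagonal (fun i => (hA.eigenvalues i : ℂ)) * (hA.eigenvectorUnitary : Matrix ι ι ℂ)ᴴ := by
  conv_lhs => rw [hA.spectral_theorem, Unitary.conjStarAlgAut_apply]
  rfl

/-- One half of trace-norm duality: in an eigenbasis of `A` only the diagonal entries of the unitary
matter, and these have modulus at most one. -/
lemma norm_trace_unitary_mul_le {A W : Matrix ι ι ℂ} (hA : A.IsHermitian)
    (hW : W ∈ unitaryGroup ι ℂ) : ‖(W * A).trace‖ ≤ traceNorm A := by
  set V : Matrix ι ι ℂ := (hA.eigenvectorUnitary : Matrix ι ι ℂ) with hV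
  have hVW : Vᴴ * W * V ∈ unitaryGroup ι ℂ :=
    mul_mem (mul_mem (Unitary.star_mem hA.eigenvectorUnitary.2) hW) hA.eigenvectorUnitary.2
  have h1 : (W * A).trace = ∑ i, (Vᴴ * W * V) i i * (hA.eigenvalues i : ℂ) := by
    conv_lhs => rw [hermitian_eq_mul_diagonal_mul hA, ← hV, ← mul_assoc, trace_mul_comm,
      ← mul_assoc, ← mul_assoc]
    simp [trace, mul_diagonal]
  rw [h1, traceNorm_eq_sum_abs_eigenvalues hA]
  refine (norm_sum_le _ _).trans (Finset.sum_le_sum fun i _ => ?_)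
  rw [norm_mul, Complex.norm_real, Real.norm_eq_abs]
  exact mul_le_of_le_one_left (abs_nonneg _) (entry_norm_bound_of_unitary hVW i i)

/-- Duality is attained at the sign of `A`, with zero eigenvalues sent to `1` so that the sign is
unitary. Being also Hermitian it is an involution, as the Fuchs–van de Graaf argument requires. -/
lemma exists_unitary_trace_mul_eq_traceNorm {A : Matrix ι ι ℂ} (hA : A.IsHermitian) :
    ∃ W ∈ unitaryGroup ι ℂ, W.IsHermitian ∧ (W * A).trace = traceNorm A := by
  set V : Matrix ι ι ℂ := (hA.eigenvectorUnitary : Matrix ι ι ℂ) with hV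
  have hVV : Vᴴ * V = 1 := (mem_unitaryGroup_iff'.mp hA.eigenvectorUnitary.2)
  have hVV' : V * Vᴴ = 1 := (mem_unitaryGroup_iff.mp hA.eigenvectorUnitary.2)
  set s : ι → ℂ := fun i => if 0 ≤ hA.eigenvalues i then 1 else -1 with hs
  have hstar : (diagonal s)ᴴ = diagonal s := by
    rw [diagonal_conjTranspose]
    congr 1
    ext i
    by_cases h : 0 ≤ hA.eigenvalues i <;> simp [hs, h]
  have hss : diagonal s * diagonal s = 1 := by
    rw [diagonal_mul_diagonal, ← diagonal_one]
    congr 1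
    ext i
    by_cases h : 0 ≤ hA.eigenvalues i <;> simp [hs, h]
  have hherm : (V * diagonal s * Vᴴ)ᴴ = V * diagonal s * Vᴴ := by
    simp only [conjTranspose_mul, conjTranspose_conjTranspose, hstar, mul_assoc]
  refine ⟨V * diagonal s * Vᴴ, ?_, hherm, ?_⟩
  · rw [mem_unitaryGroup_iff, star_eq_conjTranspose, hherm]
    calc V * diagonal s * Vᴴ * (V * diagonal s * Vᴴ)
        = V * diagonal s * (Vᴴ * V) * diagonal s * Vᴴ := by simp only [mul_assoc]
      _ = V * (diagonal s * diagonal s) * Vᴴ := by rw [hVV]; simp only [mul_assoc, one_mul]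
      _ = 1 := by rw [hss, mul_one, hVV']
  · conv_lhs => rw [hermitian_eq_mul_diagonal_mul hA, ← hV]
    calc (V * diagonal s * Vᴴ * (V * diagonal (fun i => (hA.eigenvalues i : ℂ)) * Vᴴ)).trace
        = (V * (diagonal s * (Vᴴ * V) * diagonal (fun i => (hA.eigenvalues i : ℂ)) *
            Vᴴ)).trace := by
          simp only [mul_assoc]
      _ = (diagonal s * diagonal (fun i => (hA.eigenvalues i : ℂ))).trace := by
          rw [trace_mul_comm, hVV, mul_one, mul_assoc, hVV, mul_one]
      _ = traceNorm A := by
          rw [diagonal_mul_diagonal, trace_diagonal, traceNorm_eq_sum_abs_eigenvalues hA]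
          push_cast
          refine Finset.sum_congr rfl fun i _ => ?_
          by_cases h : 0 ≤ hA.eigenvalues i
          · simp [hs, h, abs_of_nonneg h]
          · simp [hs, h, abs_of_neg (not_le.mp h)]

/-- The smallest singular value is the largest lower bound for the expansion of vectors. -/
lemma le_minSingularValue_iff [Nonempty ι] (A : Matrix ι ι ℝ) {c : ℝ} (hc : 0 ≤ c) :
    c ≤ minSingularValue A ↔ ∀ v : ι → ℝ, c ^ 2 * (v ⬝ᵥ v) ≤ (A *ᵥ v) ⬝ᵥ (A *ᵥ v) := by
  have hB := isHermitian_conjTranspose_mul_self A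
  have hcard : 0 < Fintype.card ι := Fintype.card_pos
  have hpos : ∀ i, 0 ≤ hB.eigenvalues i := (posSemidef_conjTranspose_mul_self A).eigenvalues_nonneg
  have hquad : ∀ v : ι → ℝ, (A *ᵥ v) ⬝ᵥ (A *ᵥ v) = v ⬝ᵥ ((Aᴴ * A) *ᵥ v) := fun v => by
    rw [← mulVec_mulVec, conjTranspose_eq_transpose_of_trivial, dotProduct_mulVec v,
      vecMul_transpose]
  have hmin : minSingularValue A = √(hB.eigenvalues₀ ⟨Fintype.card ι - 1, by omega⟩) :=
    singularValues_toEuclideanLin A ⟨Fintype.card ι - 1, by omega⟩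
  obtain ⟨i₀, hi₀⟩ : ∃ i, hB.eigenvalues i = hB.eigenvalues₀ ⟨Fintype.card ι - 1, by omega⟩ :=
    ⟨Fintype.equivOfCardEq (Fintype.card_fin _) ⟨Fintype.card ι - 1, by omega⟩, by
      simp [IsHermitian.eigenvalues]⟩
  have hle : ∀ i, hB.eigenvalues i₀ ≤ hB.eigenvalues i := fun i => by
    rw [hi₀]
    exact hB.eigenvalues₀_antitone (Fin.mk_le_mk.mpr (by omega))
  rw [hmin, ← hi₀, Real.le_sqrt hc (hpos _)]
  constructor
  · intro h v
    rw [hquad]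
    set B := hB.eigenvectorBasis
    set x : EuclideanSpace ℝ ι := WithLp.toLp 2 v with hx
    have hinner : ∀ i, inner ℝ (B i) (WithLp.toLp 2 ((Aᴴ * A) *ᵥ v)) =
        hB.eigenvalues i * inner ℝ (B i) x := fun i => by
      rw [EuclideanSpace.inner_eq_star_dotProduct, EuclideanSpace.inner_eq_star_dotProduct]
      have := hB.mulVec_eigenvectorBasis i
      simp only [star_trivial, hx]
      rw [dotProduct_comm, dotProduct_mulVec, ← mulVec_transpose,
        ← conjTranspose_eq_transpose_of_trivial, hB.eq, this, smul_dotProduct, dotProduct_comm,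
        smul_eq_mul]
    -- Parseval in the eigenbasis of `Aᴴ * A`, for both quadratic forms; they are then compared term
    -- by term.
    have h1 := B.sum_inner_mul_inner x x
    have h2 := B.sum_inner_mul_inner x (WithLp.toLp 2 ((Aᴴ * A) *ᵥ v))
    have hvv : inner ℝ x x = v ⬝ᵥ v := by
      rw [EuclideanSpace.inner_eq_star_dotProduct]
      simp [hx]
    have hvB : inner ℝ x (WithLp.toLp 2 ((Aᴴ * A) *ᵥ v)) = v ⬝ᵥ ((Aᴴ * A) *ᵥ v) := by
      simp [EuclideanSpace.inner_eq_star_dotProduct, hx, dotProduct_comm]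
    rw [← hvv, ← hvB, ← h1, ← h2, Finset.mul_sum]
    refine Finset.sum_le_sum fun i _ => ?_
    rw [hinner, real_inner_comm x (B i)]
    nlinarith [mul_self_nonneg (inner ℝ (B i) x), h.trans (hle i)]
  · intro h
    have h1 := h (hB.eigenvectorBasis i₀)
    rw [hquad, hB.mulVec_eigenvectorBasis, dotProduct_smul] at h1
    have h2 : (hB.eigenvectorBasis i₀ : ι → ℝ) ⬝ᵥ (hB.eigenvectorBasis i₀) = 1 := by
      have := hB.eigenvectorBasis.orthonormal.1 i₀
      have h3 := real_inner_self_eq_norm_sq (hB.eigenvectorBasis i₀)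
      rw [this, EuclideanSpace.inner_eq_star_dotProduct] at h3
      simpa using h3
    rw [h2] at h1
    simpa using h1

omit [DecidableEq ι] in
-- Singular values of an anti-symmetric matrix come in equal pairs, so the squared operator norm is
-- at most half the squared Frobenius norm. Concretely, `E` pairs with the anti-symmetric matrix `w
-- vᵀ - v wᵀ`, whose Frobenius norm is given by Lagrange's identity, and Cauchy–Schwarz applies.
lemma antisymm_mulVec_sq_le {E : Matrix ι ι ℝ} (hE : Eᵀ = -E) (v : ι → ℝ) :
    2 * ((E *ᵥ v) ⬝ᵥ (E *ᵥ v)) ≤ (∑ i, ∑ j, E i j ^ 2) * (v ⬝ᵥ v) := by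
  set w := E *ᵥ v with hw
  have hEt : ∀ i j, E j i = -E i j := fun i j => congrFun (congrFun hE i) j
  have h1 : ∑ p : ι × ι, E p.1 p.2 * (w p.1 * v p.2 - v p.1 * w p.2) = 2 * (w ⬝ᵥ w) := by
    have ha : ∑ i, ∑ j, E i j * (w i * v j) = w ⬝ᵥ w := by
      simp only [dotProduct]
      refine Finset.sum_congr rfl fun i _ => ?_
      have hwi : w i = ∑ j, E i j * v j := rfl
      rw [hwi, Finset.mul_sum]
      refine Finset.sum_congr rfl fun j _ => ?_
      rw [← hwi]
      ring
    have hb : ∑ i, ∑ j, E i j * (v i * w j) = -(w ⬝ᵥ w) := by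
      rw [Finset.sum_comm, ← ha, ← Finset.sum_neg_distrib]
      refine Finset.sum_congr rfl fun i _ => ?_
      rw [← Finset.sum_neg_distrib]
      refine Finset.sum_congr rfl fun j _ => ?_
      rw [hEt i j]; ring
    rw [Fintype.sum_prod_type]
    simp only [mul_sub, Finset.sum_sub_distrib, ha, hb]
    ring
  have h2 : ∑ p : ι × ι, (w p.1 * v p.2 - v p.1 * w p.2) ^ 2 =
      2 * ((w ⬝ᵥ w) * (v ⬝ᵥ v)) - 2 * (w ⬝ᵥ v) ^ 2 := by
    have h3 : ∀ p : ι × ι, (w p.1 * v p.2 - v p.1 * w p.2) ^ 2 =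
      (w p.1 * w p.1) * (v p.2 * v p.2) + (v p.1 * v p.1) * (w p.2 * w p.2) -
        2 * ((w p.1 * v p.1) * (w p.2 * v p.2)) := fun p => by ring
    simp only [h3, Fintype.sum_prod_type, Finset.sum_sub_distrib, Finset.sum_add_distrib,
      ← Finset.mul_sum, ← Finset.sum_mul]
    simp only [dotProduct]
    ring
  have h4 := Finset.sum_mul_sq_le_sq_mul_sq Finset.univ (fun p : ι × ι => E p.1 p.2)
    (fun p => w p.1 * v p.2 - v p.1 * w p.2)
  rw [h1, h2, Fintype.sum_prod_type] at h4
  simp only at h4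
  set F := ∑ i, ∑ j, E i j ^ 2
  have hF : 0 ≤ F := by positivity
  have hww : 0 ≤ w ⬝ᵥ w := by simpa using dotProduct_star_self_nonneg w
  have h5 : (2 * (w ⬝ᵥ w)) * (w ⬝ᵥ w) ≤ (F * (v ⬝ᵥ v)) * (w ⬝ᵥ w) := by
    nlinarith [mul_nonneg hF (sq_nonneg (w ⬝ᵥ v))]
  rcases hww.eq_or_lt with h0 | h0
  · rw [← h0, mul_zero]
    have : 0 ≤ v ⬝ᵥ v := by simpa using dotProduct_star_self_nonneg v
    positivity
  · exact le_of_mul_le_mul_right h5 h0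

omit [DecidableEq ι] in
lemma norm_sq_map_ofReal_mulVec (E : Matrix ι ι ℝ) (z : ι → ℂ) :
    ∑ i, ‖(E.map (fun r : ℝ => (r : ℂ)) *ᵥ z) i‖ ^ 2 =
      (E *ᵥ fun i => (z i).re) ⬝ᵥ (E *ᵥ fun i => (z i).re) +
      (E *ᵥ fun i => (z i).im) ⬝ᵥ (E *ᵥ fun i => (z i).im) := by
  simp only [dotProduct, ← Finset.sum_add_distrib]
  refine Finset.sum_congr rfl fun i _ => ?_
  have hre : ((E.map (fun r : ℝ => (r : ℂ)) *ᵥ z) i).re = (E *ᵥ fun i => (z i).re) i := by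
    simp [mulVec, dotProduct]
  have him : ((E.map (fun r : ℝ => (r : ℂ)) *ᵥ z) i).im = (E *ᵥ fun i => (z i).im) i := by
    simp [mulVec, dotProduct]
  rw [← Complex.normSq_eq_norm_sq, Complex.normSq_apply, hre, him]

/-- A real matrix acts separately on real and imaginary parts, so its complex operator norm can be
tested on real vectors. -/
lemma opNorm_map_ofReal_le_iff (E : Matrix ι ι ℝ) {c : ℝ} (hc : 0 ≤ c) :
    opNorm (E.map (fun r : ℝ => (r : ℂ))) ≤ c ↔
      ∀ v : ι → ℝ, (E *ᵥ v) ⬝ᵥ (E *ᵥ v) ≤ c ^ 2 * (v ⬝ᵥ v) := by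
  have happ : ∀ z : EuclideanSpace ℂ ι, ‖toEuclideanCLM (n := ι) (𝕜 := ℂ)
      (E.map (fun r : ℝ => (r : ℂ))) z‖ ^ 2 =
        ∑ i, ‖(E.map (fun r : ℝ => (r : ℂ)) *ᵥ z.ofLp) i‖ ^ 2 := fun z => by
    rw [EuclideanSpace.norm_sq_eq]
    rfl
  constructor
  · intro h v
    have h1 := ContinuousLinearMap.le_of_opNorm_le _ h (WithLp.toLp 2 fun i => (v i : ℂ))
    have h2 := pow_le_pow_left₀ (norm_nonneg _) h1 2
    rw [happ, norm_sq_map_ofReal_mulVec, mul_pow, EuclideanSpace.norm_sq_eq] at h2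
    have h0 : (E *ᵥ fun _ => (0 : ℝ)) = 0 := mulVec_zero E
    simpa [h0, dotProduct, pow_two] using h2
  · intro h
    refine ContinuousLinearMap.opNorm_le_bound _ hc fun z => ?_
    refine le_of_sq_le_sq ?_ (by positivity)
    rw [happ, norm_sq_map_ofReal_mulVec, mul_pow, EuclideanSpace.norm_sq_eq]
    refine (add_le_add (h _) (h _)).trans_eq ?_
    rw [← mul_add]
    congr 1
    simp only [dotProduct, ← Finset.sum_add_distrib]
    refine Finset.sum_congr rfl fun i _ => ?_
    rw [← Complex.normSq_eq_norm_sq, Complex.normSq_apply]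

end MatrixFacts

/-! ### Pauli tensor products and the canonical anticommutation relations -/

noncomputable section MajoranaAlgebra

variable {n : ℕ}

lemma tensor_apply (A : Fin n → Matrix (Fin 2) (Fin 2) ℂ) (x y : Basis n) :
    tensor A x y = ∏ j, A j (x j) (y j) := rfl

lemma tensor_mul (A B : Fin n → Matrix (Fin 2) (Fin 2) ℂ) :
    tensor A * tensor B = tensor fun j => A j * B j := by
  ext x z
  simp only [mul_apply, tensor_apply, ← Finset.prod_mul_distrib]
  rw [Finset.prod_univ_sum, Fintype.piFinset_univ]

lemma tensor_conjTranspose (A : Fin n → Matrix (Fin 2) (Fin 2) ℂ) :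
    (tensor A)ᴴ = tensor fun j => (A j)ᴴ := by
  ext x y
  simp [conjTranspose_apply, tensor_apply]

lemma tensor_one : tensor (fun _ : Fin n => (1 : Matrix (Fin 2) (Fin 2) ℂ)) = 1 := by
  ext x y
  rw [tensor_apply]
  by_cases h : x = y
  · subst h
    rw [one_apply_eq]
    exact Finset.prod_eq_one fun j _ => one_apply_eq _
  · obtain ⟨j, hj⟩ := Function.ne_iff.mp h
    rw [one_apply_ne h]
    exact Finset.prod_eq_zero (Finset.mem_univ j) (one_apply_ne hj)

lemma tensor_smul (c : Fin n → ℂ) (A : Fin n → Matrix (Fin 2) (Fin 2) ℂ) :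
    tensor (fun j => c j • A j) = (∏ j, c j) • tensor A := by
  ext x y
  simp [tensor_apply, Finset.prod_mul_distrib]

lemma pauliX_mul_self : pauliX * pauliX = 1 := by
  ext i j; fin_cases i <;> fin_cases j <;> simp [pauliX, mul_apply]

lemma pauliY_mul_self : pauliY * pauliY = 1 := by
  ext i j; fin_cases i <;> fin_cases j <;> simp [pauliY, mul_apply]

lemma pauliZ_mul_self : pauliZ * pauliZ = 1 := by
  ext i j; fin_cases i <;> fin_cases j <;> simp [pauliZ, mul_apply]

lemma pauliX_mul_pauliY : pauliX * pauliY = Complex.I • pauliZ := by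
  ext i j; fin_cases i <;> fin_cases j <;> simp [pauliX, pauliY, pauliZ, mul_apply]

lemma pauliY_mul_pauliX : pauliY * pauliX = -(pauliX * pauliY) := by
  ext i j; fin_cases i <;> fin_cases j <;> simp [pauliX, pauliY, mul_apply]

lemma pauliX_mul_pauliZ : pauliX * pauliZ = -(pauliZ * pauliX) := by
  ext i j; fin_cases i <;> fin_cases j <;> simp [pauliX, pauliZ, mul_apply]

lemma pauliY_mul_pauliZ : pauliY * pauliZ = -(pauliZ * pauliY) := by
  ext i j; fin_cases i <;> fin_cases j <;> simp [pauliY, pauliZ, mul_apply]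

lemma pauliX_conjTranspose : pauliXᴴ = pauliX := by
  ext i j; fin_cases i <;> fin_cases j <;> simp [pauliX]

lemma pauliY_conjTranspose : pauliYᴴ = pauliY := by
  ext i j; fin_cases i <;> fin_cases j <;> simp [pauliY]

lemma pauliZ_conjTranspose : pauliZᴴ = pauliZ := by
  ext i j; fin_cases i <;> fin_cases j <;> simp [pauliZ]

/-- The single-qubit Pauli matrix by which a Majorana operator acts on its own mode. -/
def modePauli (s : Fin 2) : Matrix (Fin 2) (Fin 2) ℂ := if s = 0 then pauliX else pauliY

lemma modePauli_mul_self (s : Fin 2) : modePauli s * modePauli s = 1 := by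
  fin_cases s <;> simp [modePauli, pauliX_mul_self, pauliY_mul_self]

lemma modePauli_mul_pauliZ (s : Fin 2) : modePauli s * pauliZ = -(pauliZ * modePauli s) := by
  fin_cases s <;> simp [modePauli, pauliX_mul_pauliZ, pauliY_mul_pauliZ]

lemma modePauli_conjTranspose (s : Fin 2) : (modePauli s)ᴴ = modePauli s := by
  fin_cases s <;> simp [modePauli, pauliX_conjTranspose, pauliY_conjTranspose]

lemma modePauli_anticomm {s t : Fin 2} (h : s ≠ t) :
    modePauli s * modePauli t = -(modePauli t * modePauli s) := by
  fin_cases s <;> fin_cases t <;> simp [modePauli, pauliY_mul_pauliX] at h ⊢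

lemma modePauli_diag (s i : Fin 2) : modePauli s i i = 0 := by
  fin_cases s <;> fin_cases i <;> simp [modePauli, pauliX, pauliY]

/-- The single-qubit tensor factors of a Majorana operator. -/
def majoranaFactor (μ : Label n) (j : Fin n) : Matrix (Fin 2) (Fin 2) ℂ :=
  if j < μ.1 then pauliZ else if j = μ.1 then modePauli μ.2 else 1

lemma majorana_eq_tensor (μ : Label n) : majorana μ = tensor (majoranaFactor μ) := rfl

lemma majorana_conjTranspose (μ : Label n) : (majorana μ)ᴴ = majorana μ := by
  rw [majorana_eq_tensor, tensor_conjTranspose]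
  congr 1
  ext1 j
  unfold majoranaFactor
  split_ifs
  · exact pauliZ_conjTranspose
  · exact modePauli_conjTranspose _
  · exact conjTranspose_one

lemma majorana_mul_self (μ : Label n) : majorana μ * majorana μ = 1 := by
  rw [majorana_eq_tensor, tensor_mul, ← tensor_one]
  congr 1
  ext1 j
  unfold majoranaFactor
  split_ifs
  · exact pauliZ_mul_self
  · exact modePauli_mul_self _
  · exact mul_one _

/-- A single anticommuting site contributes the only sign. All anticommutations among Majorana
operators and the parity reduce to this. -/
lemma tensor_mul_eq_neg {A B : Fin n → Matrix (Fin 2) (Fin 2) ℂ} (k : Fin n)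
    (hk : A k * B k = -(B k * A k)) (h : ∀ j, j ≠ k → A j * B j = B j * A j) :
    tensor A * tensor B = -(tensor B * tensor A) := by
  have h1 : (fun j => A j * B j) =
      fun j => (if j = k then (-1 : ℂ) else 1) • (B j * A j) := by
    ext1 j
    by_cases hj : j = k
    · subst hj
      simp [hk]
    · simp [hj, h j hj]
  rw [tensor_mul, h1, tensor_smul, tensor_mul, Finset.prod_ite_eq' Finset.univ k]
  simp

lemma majorana_anticomm_of_lt {μ ν : Label n} (h : μ.1 < ν.1) :
    majorana μ * majorana ν = -(majorana ν * majorana μ) := by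
  refine tensor_mul_eq_neg (A := majoranaFactor μ) (B := majoranaFactor ν) μ.1 ?_ ?_
  · simp [majoranaFactor, h, modePauli_mul_pauliZ]
  · intro j hj
    unfold majoranaFactor
    rcases lt_or_gt_of_ne hj with h1 | h1
    · simp [h1, h1.trans h]
    · simp [hj, not_lt.mpr h1.le]

lemma majorana_anticomm {μ ν : Label n} (h : μ ≠ ν) :
    majorana μ * majorana ν = -(majorana ν * majorana μ) := by
  rcases lt_trichotomy μ.1 ν.1 with h1 | h1 | h1
  · exact majorana_anticomm_of_lt h1
  · have h2 : μ.2 ≠ ν.2 := fun h2 => h (Prod.ext h1 h2)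
    refine tensor_mul_eq_neg (A := majoranaFactor μ) (B := majoranaFactor ν) μ.1 ?_ ?_
    · simpa [majoranaFactor, h1] using modePauli_anticomm h2
    · intro j hj
      unfold majoranaFactor
      rw [← h1]
      rcases lt_or_gt_of_ne hj with h3 | h3
      · simp [h3]
      · simp [hj, not_lt.mpr h3.le]
  · rw [majorana_anticomm_of_lt h1, neg_neg]

/-- The parity operator `Z ⊗ ⋯ ⊗ Z`. -/
def parity (n : ℕ) : Op n := tensor fun _ => pauliZ

lemma parity_mul_self : parity n * parity n = 1 := by
  rw [parity, tensor_mul, ← tensor_one]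
  simp only [pauliZ_mul_self]

lemma parity_conjTranspose : (parity n)ᴴ = parity n := by
  rw [parity, tensor_conjTranspose]
  simp only [pauliZ_conjTranspose]

lemma parity_mul_majorana (μ : Label n) : parity n * majorana μ = -(majorana μ * parity n) := by
  refine tensor_mul_eq_neg (A := fun _ => pauliZ) (B := majoranaFactor μ) μ.1 ?_ ?_
  · simp [majoranaFactor, modePauli_mul_pauliZ]
  · intro j hj
    unfold majoranaFactor
    split_ifs <;> simp

/-- `(-1) ^ x`. -/
def bitSign (x : Fin 2) : ℝ := if x = 0 then 1 else -1

lemma bitSign_mem_Icc (x : Fin 2) : bitSign x ∈ Set.Icc (-1 : ℝ) 1 := by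
  fin_cases x <;> simp [bitSign]

/-- The two Majorana operators of a mode multiply to `i Z`. -/
lemma majorana_zero_mul_majorana_one (k : Fin n) :
    majorana (k, 0) * majorana (k, 1) =
      Complex.I • diagonal fun x : Basis n => (bitSign (x k) : ℂ) := by
  have h1 : (fun j => majoranaFactor (k, (0 : Fin 2)) j * majoranaFactor (k, 1) j) =
      fun j => (if j = k then Complex.I else 1) • (if j = k then pauliZ else 1) := by
    ext1 j
    unfold majoranaFactor
    rcases lt_trichotomy j k with h | h | h
    · simp [h, h.ne, pauliZ_mul_self]
    · simp [h, modePauli, pauliX_mul_pauliY]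
    · simp [h.ne', not_lt.mpr h.le]
  rw [majorana_eq_tensor, majorana_eq_tensor, tensor_mul, h1, tensor_smul,
    Finset.prod_ite_eq' Finset.univ k]
  simp only [Finset.mem_univ, if_true]
  congr 1
  ext x y
  rw [tensor_apply]
  by_cases h : x = y
  · subst h
    rw [diagonal_apply_eq, Finset.prod_eq_single k]
    · rw [if_pos rfl]
      generalize x k = b
      fin_cases b <;> simp [pauliZ, bitSign]
    · intro j _ hj
      simp [hj]
    · simp
  · obtain ⟨j, hj⟩ := Function.ne_iff.mp h
    rw [diagonal_apply_ne _ h]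
    refine Finset.prod_eq_zero (Finset.mem_univ j) ?_
    split_ifs
    · generalize x j = a at hj ⊢
      generalize y j = b at hj ⊢
      fin_cases a <;> fin_cases b <;> simp [pauliZ] at hj ⊢
    · exact one_apply_ne hj

/-- Majorana operators of different modes multiply to an operator with vanishing diagonal. -/
lemma majorana_mul_majorana_diag {μ ν : Label n} (h : μ.1 ≠ ν.1) (x : Basis n) :
    (majorana μ * majorana ν) x x = 0 := by
  rw [majorana_eq_tensor, majorana_eq_tensor, tensor_mul, tensor_apply]
  rcases lt_or_gt_of_ne h with h1 | h1
  · refine Finset.prod_eq_zero (Finset.mem_univ ν.1) ?_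
    simp [majoranaFactor, h1.ne', not_lt.mpr h1.le, modePauli_diag]
  · refine Finset.prod_eq_zero (Finset.mem_univ μ.1) ?_
    simp [majoranaFactor, h1.ne', not_lt.mpr h1.le, modePauli_diag]

/-- The real linear combination of the Majorana operators with given coefficients. -/
def majoranaVec (v : Label n → ℝ) : Op n := ∑ μ, (v μ : ℂ) • majorana μ

lemma majoranaVec_single (μ : Label n) : majoranaVec (Pi.single μ 1) = majorana μ := by
  rw [majoranaVec, Finset.sum_eq_single μ] <;> simp +contextual

lemma majoranaVec_smul (c : ℝ) (v : Label n → ℝ) :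
    majoranaVec (c • v) = (c : ℂ) • majoranaVec v := by
  simp [majoranaVec, mul_smul, Finset.smul_sum]

lemma majoranaVec_sub (v w : Label n → ℝ) :
    majoranaVec (v - w) = majoranaVec v - majoranaVec w := by
  simp [majoranaVec, sub_smul, Finset.sum_sub_distrib]

lemma majoranaVec_conjTranspose (v : Label n → ℝ) : (majoranaVec v)ᴴ = majoranaVec v := by
  simp [majoranaVec, conjTranspose_sum, majorana_conjTranspose]

/-- The canonical anticommutation relations. -/
lemma majoranaVec_mul_add (v w : Label n → ℝ) :
    majoranaVec v * majoranaVec w + majoranaVec w * majoranaVec v =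
      ((2 * (v ⬝ᵥ w) : ℝ) : ℂ) • 1 := by
  have h1 : majoranaVec w * majoranaVec v =
      ∑ μ, ∑ ν, ((v μ : ℂ) * (w ν : ℂ)) • (majorana ν * majorana μ) := by
    simp only [majoranaVec, Finset.sum_mul_sum, smul_mul_smul_comm]
    rw [Finset.sum_comm]
    simp only [mul_comm]
  have h2 : majoranaVec v * majoranaVec w =
      ∑ μ, ∑ ν, ((v μ : ℂ) * (w ν : ℂ)) • (majorana μ * majorana ν) := by
    simp only [majoranaVec, Finset.sum_mul_sum, smul_mul_smul_comm]
  rw [h1, h2]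
  simp only [← Finset.sum_add_distrib, ← smul_add]
  have h3 : ∀ μ ν : Label n, majorana μ * majorana ν + majorana ν * majorana μ =
      if μ = ν then (2 : ℂ) • (1 : Op n) else 0 := fun μ ν => by
    split_ifs with h
    · subst h
      rw [majorana_mul_self, two_smul]
    · rw [majorana_anticomm h, neg_add_cancel]
  simp only [h3, smul_ite, smul_zero, Finset.sum_ite_eq, Finset.mem_univ, if_true, smul_smul,
    ← Finset.sum_smul]
  congr 1
  simp only [dotProduct]
  push_cast
  rw [Finset.mul_sum]
  exact Finset.sum_congr rfl fun _ _ => by ring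

lemma majoranaVec_mul_self (v : Label n → ℝ) :
    majoranaVec v * majoranaVec v = ((v ⬝ᵥ v : ℝ) : ℂ) • 1 := by
  have h := majoranaVec_mul_add v v
  rw [← two_smul ℂ, Complex.ofReal_mul, mul_smul, Complex.ofReal_ofNat] at h
  exact smul_right_injective _ two_ne_zero h

lemma parity_mul_majoranaVec (v : Label n → ℝ) :
    parity n * majoranaVec v = -(majoranaVec v * parity n) := by
  simp [majoranaVec, Finset.mul_sum, Finset.sum_mul, parity_mul_majorana]

lemma majoranaVec_mem_unitaryGroup {v : Label n → ℝ} (hv : v ⬝ᵥ v = 1) :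
    majoranaVec v ∈ unitaryGroup (Basis n) ℂ := by
  rw [mem_unitaryGroup_iff, star_eq_conjTranspose, majoranaVec_conjTranspose,
    majoranaVec_mul_self, hv, Complex.ofReal_one, one_smul]

lemma parity_mem_unitaryGroup : parity n ∈ unitaryGroup (Basis n) ℂ := by
  rw [mem_unitaryGroup_iff, star_eq_conjTranspose, parity_conjTranspose, parity_mul_self]

end MajoranaAlgebra

/-! ### Orthogonal transformations of the modes and the correlation matrix -/

noncomputable section FreeFermionicUnitaries

variable {n : ℕ}

/-- Conjugation by a unit Majorana combination fixes `u` and negates its orthogonal complement: it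
is minus the reflection in the hyperplane `uᗮ`. -/
lemma majoranaVec_mul_mul_self {u : Label n → ℝ} (hu : u ⬝ᵥ u = 1) (w : Label n → ℝ) :
    majoranaVec u * majoranaVec w * majoranaVec u =
      majoranaVec ((2 * (u ⬝ᵥ w)) • u - w) := by
  have h : majoranaVec u * majoranaVec w =
      ((2 * (u ⬝ᵥ w) : ℝ) : ℂ) • 1 - majoranaVec w * majoranaVec u :=
    eq_sub_of_add_eq (majoranaVec_mul_add u w)
  rw [h, sub_mul, mul_assoc, majoranaVec_mul_self, hu, smul_mul_assoc, one_mul,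
    majoranaVec_sub, majoranaVec_smul, Complex.ofReal_one, one_smul, mul_one]

lemma parity_mul_majoranaVec_mul_parity (w : Label n → ℝ) :
    parity n * majoranaVec w * parity n = -majoranaVec w := by
  rw [parity_mul_majoranaVec, neg_mul, mul_assoc, parity_mul_self, mul_one]

/-- Every real orthogonal transformation of the Majorana operators is implemented by a unitary. -/
lemma exists_unitary_implementing
    (φ : EuclideanSpace ℝ (Label n) ≃ₗᵢ[ℝ] EuclideanSpace ℝ (Label n)) :
    ∃ U ∈ unitaryGroup (Basis n) ℂ, ∀ w : EuclideanSpace ℝ (Label n),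
      Uᴴ * majoranaVec w.ofLp * U = majoranaVec (φ w).ofLp := by
  -- Cartan–Dieudonné: reflections generate the orthogonal group, so only reflections need an
  -- explicit unitary.
  have hφ : φ ∈ Subgroup.closure (Set.range fun v : EuclideanSpace ℝ (Label n) =>
      (ℝ ∙ v)ᗮ.reflection) := by
    rw [LinearIsometryEquiv.reflections_generate]
    trivial
  induction hφ using Subgroup.closure_induction with
  | mem φ h =>
    obtain ⟨v, rfl⟩ := h
    by_cases hv : v = 0
    · refine ⟨1, one_mem _, fun w => ?_⟩
      have h1 : (ℝ ∙ v)ᗮ.reflection w = w := by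
        rw [Submodule.reflection_orthogonal_apply, Submodule.reflection_singleton_apply, hv]
        simp
      rw [h1, conjTranspose_one, one_mul, mul_one]
    · set u : EuclideanSpace ℝ (Label n) := ‖v‖⁻¹ • v with hu
      have hv' : ‖v‖ ≠ 0 := norm_ne_zero_iff.mpr hv
      have huu : u.ofLp ⬝ᵥ u.ofLp = 1 := by
        have h1 : inner ℝ u u = 1 := by
          rw [real_inner_self_eq_norm_sq, hu, norm_smul, norm_inv, norm_norm,
            inv_mul_cancel₀ hv', one_pow]
        rw [EuclideanSpace.inner_eq_star_dotProduct] at h1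
        simpa using h1
      -- Conjugation by `majoranaVec u` is minus the reflection; the parity negates every Majorana
      -- operator and corrects the sign.
      refine ⟨majoranaVec u.ofLp * parity n,
        mul_mem (majoranaVec_mem_unitaryGroup huu) parity_mem_unitaryGroup, fun w => ?_⟩
      have h2 : ((ℝ ∙ v)ᗮ.reflection w).ofLp = -((2 * (u.ofLp ⬝ᵥ w.ofLp)) • u.ofLp - w.ofLp) := by
        have h3 : inner ℝ v w = v.ofLp ⬝ᵥ w.ofLp := by
          rw [EuclideanSpace.inner_eq_star_dotProduct, dotProduct_comm]
          simp
        rw [Submodule.reflection_orthogonal_apply, Submodule.reflection_singleton_apply, h3, hu]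
        ext μ
        simp
        field_simp
      rw [conjTranspose_mul, parity_conjTranspose, majoranaVec_conjTranspose, h2,
        ← neg_one_smul ℝ, majoranaVec_smul, ← majoranaVec_mul_mul_self huu]
      calc parity n * majoranaVec u.ofLp * majoranaVec w.ofLp * (majoranaVec u.ofLp * parity n)
          = parity n * (majoranaVec u.ofLp * majoranaVec w.ofLp * majoranaVec u.ofLp) *
            parity n := by simp only [mul_assoc]
        _ = _ := by
          rw [majoranaVec_mul_mul_self huu, parity_mul_majoranaVec_mul_parity]
          simp
  | one => exact ⟨1, one_mem _, fun w => by simp⟩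
  | mul φ ψ _ _ hφ hψ =>
    obtain ⟨U, hU, hU'⟩ := hφ
    obtain ⟨V, hV, hV'⟩ := hψ
    -- `w ↦ Uᴴ w U` reverses products, hence the order `V * U` for `φ * ψ`.
    refine ⟨V * U, mul_mem hV hU, fun w => ?_⟩
    rw [conjTranspose_mul, LinearIsometryEquiv.coe_mul, Function.comp_apply, ← hU', ← hV']
    simp only [mul_assoc]
  | inv φ _ hφ =>
    obtain ⟨U, hU, hU'⟩ := hφ
    refine ⟨Uᴴ, Unitary.star_mem hU, fun w => ?_⟩
    have h1 : U * Uᴴ = 1 := mem_unitaryGroup_iff.mp hU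
    have h2 := hU' (φ⁻¹ w)
    rw [show φ (φ⁻¹ w) = w from φ.apply_symm_apply w] at h2
    rw [← h2, conjTranspose_conjTranspose]
    calc U * (Uᴴ * majoranaVec (φ⁻¹ w).ofLp * U) * Uᴴ
        = (U * Uᴴ) * majoranaVec (φ⁻¹ w).ofLp * (U * Uᴴ) := by simp only [mul_assoc]
      _ = _ := by rw [h1, one_mul, mul_one]

/-- Every orthonormal family of Majorana modes is carried to the standard one by a free-fermionic
unitary. -/
lemma exists_freeFermionicUnitary {e : Label n → Label n → ℝ}
    (he : ∀ μ ν, e μ ⬝ᵥ e ν = if μ = ν then 1 else 0) :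
    ∃ U : Op n, IsFreeFermionicUnitary U ∧
      ∀ μ, Uᴴ * majoranaVec (e μ) * U = majorana μ := by
  have hon : Orthonormal ℝ fun μ => (WithLp.toLp 2 (e μ) : EuclideanSpace ℝ (Label n)) := by
    rw [orthonormal_iff_ite]
    intro μ ν
    rw [EuclideanSpace.inner_eq_star_dotProduct, dotProduct_comm]
    simpa using he μ ν
  have hspan := hon.linearIndependent.span_eq_top_of_card_eq_finrank'
    (finrank_euclideanSpace (𝕜 := ℝ) (ι := Label n)).symm
  set b := OrthonormalBasis.mk hon hspan.ge with hb
  -- The coordinate map of the basis `e` is the isometry carrying `e μ` to the standard vector at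
  -- `μ`; its matrix provides `Q`.
  obtain ⟨U, hU, hU'⟩ := exists_unitary_implementing b.repr
  refine ⟨U, ⟨hU, of fun μ ν => b.repr (EuclideanSpace.single μ 1) ν, ?_, fun μ => ?_⟩, fun μ => ?_⟩
  · rw [mem_orthogonalGroup_iff]
    ext μ ν
    have h1 := b.repr.inner_map_map (EuclideanSpace.single ν (1 : ℝ)) (EuclideanSpace.single μ 1)
    rw [EuclideanSpace.inner_eq_star_dotProduct] at h1
    simp only [star_trivial] at h1
    rw [mul_apply, one_apply]
    refine Eq.trans ?_ (h1.trans ?_)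
    · simp [dotProduct]
    · simp [EuclideanSpace.inner_single_left, eq_comm]
  · have h1 := hU' (EuclideanSpace.single μ 1)
    have h2 : (EuclideanSpace.single μ (1 : ℝ)).ofLp = Pi.single μ 1 := by simp
    rw [h2, majoranaVec_single] at h1
    exact h1
  · have h1 := hU' (b μ)
    rw [b.repr_self, hb, OrthonormalBasis.coe_mk] at h1
    have h2 : (EuclideanSpace.single μ (1 : ℝ)).ofLp = Pi.single μ 1 := by simp
    rw [h2, majoranaVec_single] at h1
    exact h1

/-- The real part of the correlation matrix. -/
def realCorrelation (X : Op n) : Matrix (Label n) (Label n) ℝ :=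
  of fun μ ν => (correlationMatrix X μ ν).re

lemma star_trace_commutator {A B X : Op n} (hA : Aᴴ = A) (hB : Bᴴ = B) (hX : X.IsHermitian) :
    star (((A * B - B * A) * X).trace) = -((A * B - B * A) * X).trace := by
  rw [← trace_conjTranspose, conjTranspose_mul, hX.eq, conjTranspose_sub, conjTranspose_mul,
    conjTranspose_mul, hA, hB, trace_mul_comm, ← trace_neg, ← neg_mul, neg_sub]

/-- The commutator of Hermitian operators is anti-Hermitian, so its trace against a Hermitian
operator is imaginary and the prefactor `-i/2` makes it real. -/
lemma map_realCorrelation {X : Op n} (hX : X.IsHermitian) :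
    (realCorrelation X).map (fun r : ℝ => (r : ℂ)) = correlationMatrix X := by
  ext μ ν
  simp only [realCorrelation, map_apply, of_apply]
  refine Complex.conj_eq_iff_re.mp ?_
  have h := star_trace_commutator (majorana_conjTranspose μ) (majorana_conjTranspose ν) hX
  simp only [correlationMatrix, of_apply, map_mul, map_neg, map_div₀, Complex.conj_I, map_ofNat]
  rw [show (starRingEnd ℂ) _ = _ from h]
  ring

lemma realCorrelation_transpose (X : Op n) : (realCorrelation X)ᵀ = -realCorrelation X := by
  ext μ ν
  change (-(Complex.I / 2) * ((majorana ν * majorana μ - majorana μ * majorana ν) * X).trace).re =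
    -(-(Complex.I / 2) * ((majorana μ * majorana ν - majorana ν * majorana μ) * X).trace).re
  rw [← Complex.neg_re, ← mul_neg, ← trace_neg, ← neg_mul, neg_sub]

lemma realCorrelation_sub (X Y : Op n) :
    realCorrelation (X - Y) = realCorrelation X - realCorrelation Y := by
  ext μ ν
  simp only [realCorrelation, correlationMatrix, Matrix.sub_apply, of_apply]
  rw [← Complex.sub_re, ← mul_sub, ← trace_sub, ← mul_sub]

lemma dotProduct_realCorrelation_mulVec (X : Op n) (w v : Label n → ℝ) :
    w ⬝ᵥ (realCorrelation X *ᵥ v) = (-(Complex.I / 2) *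
      ((majoranaVec w * majoranaVec v - majoranaVec v * majoranaVec w) * X).trace).re := by
  have h1 : (majoranaVec w * majoranaVec v - majoranaVec v * majoranaVec w) * X =
      ∑ μ, ∑ ν, ((w μ : ℂ) * (v ν : ℂ)) •
        ((majorana μ * majorana ν - majorana ν * majorana μ) * X) := by
    have h2 : majoranaVec v * majoranaVec w =
        ∑ μ, ∑ ν, ((w μ : ℂ) * (v ν : ℂ)) • (majorana ν * majorana μ) := by
      simp only [majoranaVec, Finset.sum_mul_sum, smul_mul_smul_comm]
      rw [Finset.sum_comm]
      simp only [mul_comm]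
    have h3 : majoranaVec w * majoranaVec v =
        ∑ μ, ∑ ν, ((w μ : ℂ) * (v ν : ℂ)) • (majorana μ * majorana ν) := by
      simp only [majoranaVec, Finset.sum_mul_sum, smul_mul_smul_comm]
    rw [h2, h3]
    simp only [← Finset.sum_sub_distrib, ← smul_sub, Finset.sum_mul, smul_mul_assoc]
  rw [h1]
  simp only [trace_sum, trace_smul, Finset.mul_sum, Complex.re_sum, dotProduct, mulVec,
    realCorrelation, correlationMatrix, of_apply, smul_eq_mul]
  refine Finset.sum_congr rfl fun μ _ => Finset.sum_congr rfl fun ν _ => ?_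
  rw [mul_left_comm (-(Complex.I / 2)), ← Complex.ofReal_mul, Complex.re_ofReal_mul]
  ring

/-- Orthogonal coefficient vectors give anticommuting operators, so the commutator is twice the
product. -/
lemma dotProduct_realCorrelation_mulVec_of_orthogonal (X : Op n) {w v : Label n → ℝ}
    (h : w ⬝ᵥ v = 0) : w ⬝ᵥ (realCorrelation X *ᵥ v) =
      (-Complex.I * (majoranaVec w * majoranaVec v * X).trace).re := by
  have h1 : majoranaVec v * majoranaVec w = -(majoranaVec w * majoranaVec v) := by
    rw [eq_neg_iff_add_eq_zero, add_comm, majoranaVec_mul_add, h]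
    simp
  rw [dotProduct_realCorrelation_mulVec, h1, sub_neg_eq_add, ← two_smul ℂ, smul_mul_assoc,
    trace_smul, smul_eq_mul]
  congr 1
  ring

lemma realCorrelation_apply_of_ne (X : Op n) {μ ν : Label n} (h : μ ≠ ν) :
    realCorrelation X μ ν = (-Complex.I * (majorana μ * majorana ν * X).trace).re := by
  have := dotProduct_realCorrelation_mulVec_of_orthogonal X
    (w := Pi.single μ 1) (v := Pi.single ν 1) (by simp [h])
  simpa [majoranaVec_single] using this

/-- The correlation of a pair of modes is the expectation of a Pauli `Z` in the frame in which the
pair is standard. -/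
lemma realCorrelation_eq_sum_bitSign (X : Op n) {e : Label n → Label n → ℝ}
    (he : ∀ μ ν, e μ ⬝ᵥ e ν = if μ = ν then 1 else 0) {U : Op n}
    (hU : U ∈ unitaryGroup (Basis n) ℂ) (hUe : ∀ μ, Uᴴ * majoranaVec (e μ) * U = majorana μ)
    (k : Fin n) : e (k, 0) ⬝ᵥ (realCorrelation X *ᵥ e (k, 1)) =
      ∑ x : Basis n, bitSign (x k) * ((Uᴴ * X * U) x x).re := by
  have h1 : U * Uᴴ = 1 := mem_unitaryGroup_iff.mp hU
  have h2 : ∀ μ, majoranaVec (e μ) = U * majorana μ * Uᴴ := fun μ => by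
    rw [← hUe]
    calc majoranaVec (e μ) = (U * Uᴴ) * majoranaVec (e μ) * (U * Uᴴ) := by
          rw [h1, one_mul, mul_one]
      _ = _ := by simp only [mul_assoc]
  have h3 : Uᴴ * U = 1 := mem_unitaryGroup_iff'.mp hU
  rw [dotProduct_realCorrelation_mulVec_of_orthogonal _ (by rw [he]; simp), h2, h2]
  have h4 : (U * majorana (k, 0) * Uᴴ * (U * majorana (k, 1) * Uᴴ) * X).trace =
      (majorana (k, 0) * majorana (k, 1) * (Uᴴ * X * U)).trace := by
    calc _ = (U * (majorana (k, 0) * (Uᴴ * U) * majorana (k, 1) * Uᴴ * X)).trace := by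
          simp only [mul_assoc]
      _ = _ := by
          rw [trace_mul_comm, h3, mul_one]
          simp only [mul_assoc]
  rw [h4, majorana_zero_mul_majorana_one, smul_mul_assoc, trace_smul, smul_eq_mul, ← mul_assoc,
    neg_mul, Complex.I_mul_I, neg_neg, one_mul, trace, Complex.re_sum]
  refine Finset.sum_congr rfl fun x _ => ?_
  rw [diag_apply, diagonal_mul, Complex.re_ofReal_mul]

/-- After normalisation both Majorana combinations are unitary and trace-norm duality applies. Zero
vectors, which cannot be normalised, are treated apart. -/
lemma norm_trace_majoranaVec_mul_le {X : Op n} (hX : X.IsHermitian) (w v : Label n → ℝ) :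
    ‖(majoranaVec w * majoranaVec v * X).trace‖ ≤ √(w ⬝ᵥ w) * √(v ⬝ᵥ v) * traceNorm X := by
  have hnn : ∀ u : Label n → ℝ, 0 ≤ u ⬝ᵥ u := fun u => by
    simpa using dotProduct_star_self_nonneg u
  have key : ∀ u : Label n → ℝ, ∃ u' : Label n → ℝ, u' ⬝ᵥ u' = 1 ∧ u = √(u ⬝ᵥ u) • u' ∨
      u = 0 := fun u => by
    by_cases h : u ⬝ᵥ u = 0
    · exact ⟨0, Or.inr (dotProduct_self_eq_zero.mp h)⟩
    · have hs : √(u ⬝ᵥ u) ≠ 0 := (Real.sqrt_ne_zero (hnn u)).mpr h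
      refine ⟨(√(u ⬝ᵥ u))⁻¹ • u, Or.inl ⟨?_, ?_⟩⟩
      · rw [smul_dotProduct, dotProduct_smul, smul_eq_mul, smul_eq_mul]
        nth_rewrite 3 [← Real.mul_self_sqrt (hnn u)]
        field_simp
      · rw [smul_smul, mul_inv_cancel₀ hs, one_smul]
  have h0 : majoranaVec (0 : Label n → ℝ) = 0 := by simp [majoranaVec]
  obtain ⟨w', hw | hw⟩ := key w
  swap
  · simp [hw, h0]
  obtain ⟨v', hv | hv⟩ := key v
  swap
  · simp [hv, h0]
  have h1 : majoranaVec w * majoranaVec v * X =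
      ((√(w ⬝ᵥ w) * √(v ⬝ᵥ v) : ℝ) : ℂ) • (majoranaVec w' * majoranaVec v' * X) := by
    conv_lhs => rw [hw.2, hv.2]
    rw [majoranaVec_smul, majoranaVec_smul, smul_mul_smul_comm, smul_mul_assoc]
    push_cast
    rfl
  rw [h1, trace_smul, norm_smul, Complex.norm_real, Real.norm_eq_abs, abs_of_nonneg (by positivity)]
  exact mul_le_mul_of_nonneg_left (norm_trace_unitary_mul_le hX
    (mul_mem (majoranaVec_mem_unitaryGroup hw.1) (majoranaVec_mem_unitaryGroup hv.1)))
    (by positivity)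

/-- The correlation matrix is a contraction from the trace norm to the operator norm. -/
lemma realCorrelation_mulVec_sq_le {X : Op n} (hX : X.IsHermitian) (v : Label n → ℝ) :
    (realCorrelation X *ᵥ v) ⬝ᵥ (realCorrelation X *ᵥ v) ≤ traceNorm X ^ 2 * (v ⬝ᵥ v) := by
  set w := realCorrelation X *ᵥ v with hw
  have hnn : ∀ u : Label n → ℝ, 0 ≤ u ⬝ᵥ u := fun u => by
    simpa using dotProduct_star_self_nonneg u
  -- The bilinear bound is tested on `w = Γ v` itself; cancelling one factor `√(w ⬝ᵥ w)` leaves the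
  -- norm bound.
  have h1 : w ⬝ᵥ w ≤ √(w ⬝ᵥ w) * √(v ⬝ᵥ v) * traceNorm X := by
    have h2 := dotProduct_realCorrelation_mulVec X w v
    rw [← hw] at h2
    refine h2.le.trans ((Complex.re_le_norm _).trans ?_)
    rw [norm_mul, norm_neg, norm_div, Complex.norm_I, sub_mul, trace_sub]
    have h3 := norm_sub_le ((majoranaVec w * majoranaVec v * X).trace)
      ((majoranaVec v * majoranaVec w * X).trace)
    have h4 := norm_trace_majoranaVec_mul_le hX w v
    have h5 := norm_trace_majoranaVec_mul_le hX v w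
    rw [RCLike.norm_ofNat]
    rw [mul_comm √(v ⬝ᵥ v)] at h5
    linarith
  have h6 : √(w ⬝ᵥ w) ≤ √(v ⬝ᵥ v) * traceNorm X := by
    rcases (Real.sqrt_nonneg (w ⬝ᵥ w)).eq_or_lt with h | h
    · rw [← h]
      refine mul_nonneg (Real.sqrt_nonneg _) ((norm_nonneg _).trans
        (norm_trace_unitary_mul_le hX (one_mem _)))
    · nth_rewrite 1 [← Real.mul_self_sqrt (hnn w)] at h1
      rw [mul_assoc] at h1
      exact le_of_mul_le_mul_left h1 h
  have h7 := pow_le_pow_left₀ (Real.sqrt_nonneg _) h6 2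
  rw [mul_pow, Real.sq_sqrt (hnn w), Real.sq_sqrt (hnn v)] at h7
  linarith

end FreeFermionicUnitaries

/-! ### States close to a free-fermionic state (Case A) -/

noncomputable section CloseStates

variable {n : ℕ}

lemma dotProduct_self_nonneg {ι : Type} [Fintype ι] (u : ι → ℝ) : 0 ≤ u ⬝ᵥ u := by
  simpa using dotProduct_star_self_nonneg u

/-- The reverse triangle inequality, relative to a reference length `√r`. -/
lemma sub_sq_mul_le_dotProduct_add {ι : Type} [Fintype ι] {a b : ι → ℝ} {c d r : ℝ} (hr : 0 ≤ r)
    (hd : 0 ≤ d) (hdc : d ≤ c) (ha : c ^ 2 * r ≤ a ⬝ᵥ a) (hb : b ⬝ᵥ b ≤ d ^ 2 * r) :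
    (c - d) ^ 2 * r ≤ (a + b) ⬝ᵥ (a + b) := by
  have hnorm : ∀ u : ι → ℝ, ‖(WithLp.toLp 2 u : EuclideanSpace ℝ ι)‖ ^ 2 = u ⬝ᵥ u := fun u => by
    rw [EuclideanSpace.real_norm_sq_eq]
    simp [dotProduct, pow_two]
  set s := √r
  have hs : s ^ 2 = r := Real.sq_sqrt hr
  have hs0 : 0 ≤ s := Real.sqrt_nonneg r
  have h1 : c * s ≤ ‖(WithLp.toLp 2 a : EuclideanSpace ℝ ι)‖ := by
    refine le_of_sq_le_sq ?_ (norm_nonneg _)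
    rw [hnorm, mul_pow, hs]
    exact ha
  have h2 : ‖(WithLp.toLp 2 b : EuclideanSpace ℝ ι)‖ ≤ d * s := by
    refine le_of_sq_le_sq ?_ (by positivity)
    rw [hnorm, mul_pow, hs]
    exact hb
  have h3 : ‖(WithLp.toLp 2 a : EuclideanSpace ℝ ι)‖ ≤ ‖(WithLp.toLp 2 (a + b) :
      EuclideanSpace ℝ ι)‖ + ‖(WithLp.toLp 2 b : EuclideanSpace ℝ ι)‖ := by
    have := norm_sub_le (WithLp.toLp 2 (a + b) : EuclideanSpace ℝ ι) (WithLp.toLp 2 b)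
    rwa [← WithLp.toLp_sub, add_sub_cancel_right] at this
  rw [← hnorm, ← hs, ← mul_pow]
  exact pow_le_pow_left₀ (mul_nonneg (sub_nonneg.mpr hdc) hs0) (by linarith) 2

lemma dotProduct_mulVec_self_of_transpose_mul {ι : Type} [Fintype ι] [DecidableEq ι]
    {A : Matrix ι ι ℝ} (hA : Aᵀ * A = 1) (v : ι → ℝ) : (A *ᵥ v) ⬝ᵥ (A *ᵥ v) = v ⬝ᵥ v := by
  rw [dotProduct_mulVec, vecMul_mulVec, hA, vecMul_one]

/-! ### Diagonal product states -/

/-- The diagonal entries of a product state. -/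
def productWeight (l : Fin n → ℝ) (x : Basis n) : ℝ := ∏ j, (1 + l j * bitSign (x j)) / 2

lemma diagonalProductState_eq (l : Fin n → ℝ) :
    diagonalProductState l = diagonal fun x => (productWeight l x : ℂ) := by
  ext x y
  rw [diagonalProductState, tensor_apply]
  by_cases h : x = y
  · subst h
    rw [diagonal_apply_eq, productWeight, Complex.ofReal_prod]
    refine Finset.prod_congr rfl fun j _ => ?_
    generalize x j = b
    fin_cases b <;> simp [pauliZ, bitSign] <;> ring
  · obtain ⟨j, hj⟩ := Function.ne_iff.mp h
    rw [diagonal_apply_ne _ h]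
    refine Finset.prod_eq_zero (Finset.mem_univ j) ?_
    generalize x j = a at hj ⊢
    generalize y j = b at hj ⊢
    fin_cases a <;> fin_cases b <;> simp [pauliZ] at hj ⊢

lemma sum_productWeight (l : Fin n → ℝ) : ∑ x, productWeight l x = 1 := by
  have h := Finset.prod_univ_sum (fun _ : Fin n => (Finset.univ : Finset (Fin 2)))
    (fun j b => (1 + l j * bitSign b) / 2)
  rw [Fintype.piFinset_univ] at h
  simp only [productWeight]
  rw [← h]
  refine Finset.prod_eq_one fun j _ => ?_
  simp [bitSign]
  ring

lemma productWeight_factor_mem {l : Fin n → ℝ} (hl : ∀ j, l j ∈ Set.Icc (-1 : ℝ) 1)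
    (j : Fin n) (b : Fin 2) : (1 + l j * bitSign b) / 2 ∈ Set.Icc (0 : ℝ) 1 := by
  obtain ⟨h1, h2⟩ := hl j
  fin_cases b <;> constructor <;> simp [bitSign] <;> linarith

lemma productWeight_nonneg {l : Fin n → ℝ} (hl : ∀ j, l j ∈ Set.Icc (-1 : ℝ) 1) (x : Basis n) :
    0 ≤ productWeight l x :=
  Finset.prod_nonneg fun j _ => (productWeight_factor_mem hl j _).1

/-- The weights are the eigenvalues of the product state. All factors other than that of qubit `k`
are at most one, so each single `l k` bounds the largest eigenvalue. -/
lemma productWeight_le {l : Fin n → ℝ} (hl : ∀ j, l j ∈ Set.Icc (-1 : ℝ) 1) (x : Basis n)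
    (k : Fin n) : productWeight l x ≤ (1 + |l k|) / 2 := by
  rw [productWeight, ← Finset.mul_prod_erase _ _ (Finset.mem_univ k)]
  have h1 : (1 + l k * bitSign (x k)) / 2 ≤ (1 + |l k|) / 2 := by
    generalize x k = b
    have := le_abs_self (l k)
    have := neg_le_abs (l k)
    fin_cases b <;> simp [bitSign] <;> linarith
  refine (mul_le_of_le_one_right (productWeight_factor_mem hl k _).1 ?_).trans h1
  exact Finset.prod_le_one (fun j _ => (productWeight_factor_mem hl j _).1)
    fun j _ => (productWeight_factor_mem hl j _).2

lemma isState_conj_diagonalProductState {l : Fin n → ℝ} (hl : ∀ j, l j ∈ Set.Icc (-1 : ℝ) 1)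
    {U : Op n} (hU : U ∈ unitaryGroup (Basis n) ℂ) :
    IsState (U * diagonalProductState l * Uᴴ) := by
  have h3 : Uᴴ * U = 1 := mem_unitaryGroup_iff'.mp hU
  constructor
  · refine PosSemidef.mul_mul_conjTranspose_same ?_ U
    rw [diagonalProductState_eq]
    refine PosSemidef.diagonal fun x => ?_
    exact Complex.zero_le_real.mpr (productWeight_nonneg hl x)
  · rw [mul_assoc, trace_mul_comm, mul_assoc, h3, mul_one, diagonalProductState_eq, trace_diagonal,
      ← Complex.ofReal_sum, sum_productWeight, Complex.ofReal_one]

/-! ### Pure states -/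

lemma IsPure.mul_self {ρ : Op n} (hρ : IsPure ρ) : ρ * ρ = ρ := by
  have hH := hρ.1.1.1
  have hcard := hH.rank_eq_card_non_zero_eigs
  rw [hρ.2, eq_comm, Fintype.card_eq_one_iff] at hcard
  obtain ⟨⟨i, hi⟩, hi'⟩ := hcard
  have hzero : ∀ j, j ≠ i → hH.eigenvalues j = 0 := fun j hj => by
    by_contra h
    exact hj (congrArg Subtype.val (hi' ⟨j, h⟩))
  have hsum : hH.eigenvalues i = 1 := by
    have h1 := hH.trace_eq_sum_eigenvalues
    rw [hρ.1.2, Finset.sum_eq_single i (fun j _ hj => by rw [hzero j hj]; simp) (by simp)] at h1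
    exact Complex.ofReal_eq_one.mp h1.symm
  have hsq : ∀ j, (hH.eigenvalues j : ℂ) * (hH.eigenvalues j : ℂ) = hH.eigenvalues j := fun j => by
    by_cases hj : j = i
    · simp [hj, hsum]
    · simp [hzero j hj]
  have hVV : (hH.eigenvectorUnitary : Op n)ᴴ * (hH.eigenvectorUnitary : Op n) = 1 :=
    mem_unitaryGroup_iff'.mp hH.eigenvectorUnitary.2
  have hdec := hermitian_eq_mul_diagonal_mul hH
  set V : Op n := (hH.eigenvectorUnitary : Op n)
  rw [hdec]
  calc V * diagonal (fun i => (hH.eigenvalues i : ℂ)) * Vᴴ *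
        (V * diagonal (fun i => (hH.eigenvalues i : ℂ)) * Vᴴ)
      = V * diagonal (fun i => (hH.eigenvalues i : ℂ)) * (Vᴴ * V) *
        diagonal (fun i => (hH.eigenvalues i : ℂ)) * Vᴴ := by simp only [mul_assoc]
    _ = V * (diagonal (fun i => (hH.eigenvalues i : ℂ)) *
        diagonal (fun i => (hH.eigenvalues i : ℂ))) * Vᴴ := by
      rw [hVV, mul_one]; simp only [mul_assoc]
    _ = _ := by rw [diagonal_mul_diagonal]; simp only [hsq]

/-- The overlap of a pure state with a nearby state is large. -/
lemma IsPure.one_sub_le_re_trace_mul {ρ σ : Op n} (hρ : IsPure ρ) (hσ : IsState σ) :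
    1 - traceNorm (ρ - σ) / 2 ≤ (ρ * σ).trace.re := by
  -- For a projection `ρ` this is a unitary reflection. Testing `ρ - σ` against it instead of
  -- against `ρ` gains the factor `1/2`.
  have hW : (2 : ℂ) • ρ - 1 ∈ unitaryGroup (Basis n) ℂ := by
    rw [mem_unitaryGroup_iff, star_eq_conjTranspose, conjTranspose_sub, conjTranspose_smul,
      hρ.1.1.1.eq, conjTranspose_one]
    simp only [sub_mul, mul_sub, smul_mul_smul_comm, hρ.mul_self, mul_one, one_mul, star_ofNat]
    module
  have h1 := norm_trace_unitary_mul_le (hρ.1.1.1.sub hσ.1.1) hW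
  have h2 : (((2 : ℂ) • ρ - 1) * (ρ - σ)).trace = 2 - 2 * (ρ * σ).trace := by
    simp only [sub_mul, mul_sub, smul_mul_assoc, hρ.mul_self, trace_sub, trace_smul, one_mul,
      hρ.1.2, hσ.2, smul_eq_mul]
    ring
  have h3 := (Complex.re_le_norm _).trans h1
  rw [h2] at h3
  simp at h3
  linarith

/-- The overlap `Tr(ρσ)` is at least `1 - ‖ρ - σ‖₁ / 2` by purity of `ρ`, and at most `(1 + |l k|) /
2`, a bound on the eigenvalues of `σ`. Taking `ρ = σ` shows that a pure free-fermionic state has `1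
≤ |l k|`. -/
lemma one_sub_traceNorm_le_abs {ρ U : Op n} {l : Fin n → ℝ} (hρ : IsPure ρ)
    (hU : U ∈ unitaryGroup (Basis n) ℂ) (hl : ∀ j, l j ∈ Set.Icc (-1 : ℝ) 1) (k : Fin n) :
    1 - traceNorm (ρ - U * diagonalProductState l * Uᴴ) ≤ |l k| := by
  have h1 := hρ.one_sub_le_re_trace_mul (isState_conj_diagonalProductState hl hU)
  have hUU : U * Uᴴ = 1 := mem_unitaryGroup_iff.mp hU
  have h2 : (ρ * (U * diagonalProductState l * Uᴴ)).trace.re =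
      ∑ x, ((Uᴴ * ρ * U) x x).re * productWeight l x := by
    have h3 : (ρ * (U * diagonalProductState l * Uᴴ)).trace =
        ((Uᴴ * ρ * U) * diagonalProductState l).trace := by
      rw [← mul_assoc, trace_mul_comm]
      simp only [mul_assoc]
    rw [h3, diagonalProductState_eq, trace, Complex.re_sum]
    refine Finset.sum_congr rfl fun x _ => ?_
    rw [diag_apply, mul_diagonal, Complex.re_mul_ofReal]
  have h4 : (∑ x, ((Uᴴ * ρ * U) x x).re) = 1 := by
    have h5 : (Uᴴ * ρ * U).trace = 1 := by
      rw [mul_assoc, trace_mul_comm, mul_assoc, hUU, mul_one, hρ.1.2]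
    have := congrArg Complex.re h5
    simpa [trace] using this
  have h6 : ∀ x, 0 ≤ ((Uᴴ * ρ * U) x x).re := fun x =>
    (Complex.nonneg_iff.mp ((hρ.1.1.conjTranspose_mul_mul_same U).diag_nonneg (i := x))).1
  have h7 : ∑ x, ((Uᴴ * ρ * U) x x).re * productWeight l x ≤ (1 + |l k|) / 2 := by
    calc _ ≤ ∑ x, ((Uᴴ * ρ * U) x x).re * ((1 + |l k|) / 2) :=
          Finset.sum_le_sum fun x _ => mul_le_mul_of_nonneg_left (productWeight_le hl x k) (h6 x)
      _ = _ := by rw [← Finset.sum_mul, h4, one_mul]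
  rw [h2] at h1
  linarith

/-! ### Correlation matrices of free-fermionic states -/

lemma realCorrelation_conj {U X : Op n} {Q : Matrix (Label n) (Label n) ℝ}
    (hU : U ∈ unitaryGroup (Basis n) ℂ)
    (hQ : ∀ μ, Uᴴ * majorana μ * U = ∑ ν, (Q μ ν : ℂ) • majorana ν) :
    realCorrelation (U * X * Uᴴ) = Q * realCorrelation X * Qᵀ := by
  have hUU : U * Uᴴ = 1 := mem_unitaryGroup_iff.mp hU
  have hUU' : Uᴴ * U = 1 := mem_unitaryGroup_iff'.mp hU
  ext μ ν
  have h1 : (Q * realCorrelation X * Qᵀ) μ ν = Q μ ⬝ᵥ (realCorrelation X *ᵥ Q ν) := by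
    rw [mul_assoc, mul_apply]
    rfl
  have h2 : ∀ μ, majoranaVec (Q μ) = Uᴴ * majorana μ * U := fun μ => (hQ μ).symm
  rw [h1, dotProduct_realCorrelation_mulVec, h2, h2, realCorrelation, of_apply, correlationMatrix,
    of_apply]
  have h3 : ∀ A B : Op n, Uᴴ * A * U * (Uᴴ * B * U) = Uᴴ * (A * B) * U := fun A B => by
    calc _ = Uᴴ * A * (U * Uᴴ) * B * U := by simp only [mul_assoc]
      _ = _ := by rw [hUU, mul_one]; simp only [mul_assoc]
  rw [h3, h3, ← sub_mul, ← mul_sub]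
  congr 2
  rw [← mul_assoc, ← mul_assoc, trace_mul_comm]
  simp only [mul_assoc]

/-- A product of Majorana operators of different modes flips bits, so it has no diagonal for a
diagonal operator to see. -/
lemma realCorrelation_diagonal_of_ne (p : Basis n → ℂ) {μ ν : Label n} (h : μ.1 ≠ ν.1) :
    realCorrelation (diagonal p) μ ν = 0 := by
  rw [realCorrelation_apply_of_ne _ (fun h' => h (congrArg Prod.fst h')), trace,
    Finset.sum_eq_zero]
  · simp
  · intro x _
    rw [diag_apply, mul_diagonal, majorana_mul_majorana_diag h, zero_mul]

lemma realCorrelation_swap (X : Op n) (μ ν : Label n) :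
    realCorrelation X ν μ = -realCorrelation X μ ν := by
  rw [← transpose_apply (realCorrelation X), realCorrelation_transpose, Matrix.neg_apply]

lemma realCorrelation_self (X : Op n) (μ : Label n) : realCorrelation X μ μ = 0 := by
  have h := realCorrelation_swap X μ μ
  linarith

lemma realCorrelation_diagonalProductState (l : Fin n → ℝ) (k : Fin n) :
    realCorrelation (diagonalProductState l) (k, 0) (k, 1) = l k := by
  rw [realCorrelation_apply_of_ne _ (by simp), majorana_zero_mul_majorana_one,
    diagonalProductState_eq, smul_mul_assoc, trace_smul, smul_eq_mul, ← mul_assoc, neg_mul,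
    Complex.I_mul_I, neg_neg, one_mul, diagonal_mul_diagonal, trace_diagonal, Complex.re_sum]
  have h := Finset.prod_univ_sum (fun _ : Fin n => (Finset.univ : Finset (Fin 2)))
    (fun j b => (if j = k then bitSign b else 1) * ((1 + l j * bitSign b) / 2))
  rw [Fintype.piFinset_univ] at h
  have h2 : ∀ x : Basis n, ((bitSign (x k) : ℂ) * (productWeight l x : ℂ)).re =
      ∏ j, (if j = k then bitSign (x j) else 1) * ((1 + l j * bitSign (x j)) / 2) := fun x => by
    rw [← Complex.ofReal_mul, Complex.ofReal_re, Finset.prod_mul_distrib,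
      Finset.prod_ite_eq' Finset.univ k (fun j => bitSign (x j))]
    simp [productWeight]
  simp only [h2]
  rw [← h, Finset.prod_eq_single k]
  · simp [bitSign]
    ring
  · intro j _ hj
    simp [bitSign, hj]
    ring
  · simp

lemma realCorrelation_diagonalProductState_mulVec (l : Fin n → ℝ) (v : Label n → ℝ) (k : Fin n) :
    (realCorrelation (diagonalProductState l) *ᵥ v) (k, 0) = l k * v (k, 1) ∧
    (realCorrelation (diagonalProductState l) *ᵥ v) (k, 1) = -l k * v (k, 0) := by
  have h1 : ∀ s : Fin 2, (realCorrelation (diagonalProductState l) *ᵥ v) (k, s) =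
      ∑ t : Fin 2, realCorrelation (diagonalProductState l) (k, s) (k, t) * v (k, t) := fun s => by
    rw [mulVec, dotProduct, Fintype.sum_prod_type, Finset.sum_eq_single k _ (by simp)]
    intro j _ hj
    refine Finset.sum_eq_zero fun t _ => ?_
    rw [diagonalProductState_eq, realCorrelation_diagonal_of_ne _ hj.symm, zero_mul]
  have h2 : realCorrelation (diagonalProductState l) (k, 1) (k, 0) = -l k := by
    rw [realCorrelation_swap, realCorrelation_diagonalProductState]
  rw [h1, h1]
  simp [Fin.sum_univ_two, realCorrelation_self, realCorrelation_diagonalProductState, h2]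

/-- Covariance strips off the orthogonal matrix `Q`, which preserves lengths. What remains is block
diagonal with one block of off-diagonal entries `±l k` per mode. -/
lemma sq_mul_le_realCorrelation_mulVec {U : Op n} (hU : IsFreeFermionicUnitary U) {l : Fin n → ℝ}
    {c : ℝ} (hc : 0 ≤ c) (hl : ∀ k, c ≤ |l k|) (v : Label n → ℝ) :
    c ^ 2 * (v ⬝ᵥ v) ≤ (realCorrelation (U * diagonalProductState l * Uᴴ) *ᵥ v) ⬝ᵥ
      (realCorrelation (U * diagonalProductState l * Uᴴ) *ᵥ v) := by
  obtain ⟨hU, Q, hQ, hQU⟩ := hU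
  rw [realCorrelation_conj hU hQU, ← mulVec_mulVec, ← mulVec_mulVec,
    dotProduct_mulVec_self_of_transpose_mul ((mem_orthogonalGroup_iff' (Label n) ℝ).mp hQ),
    ← dotProduct_mulVec_self_of_transpose_mul (A := Qᵀ)
      (by rw [transpose_transpose]; exact (mem_orthogonalGroup_iff (Label n) ℝ).mp hQ) v]
  generalize Qᵀ *ᵥ v = w
  simp only [dotProduct, Fintype.sum_prod_type, Fin.sum_univ_two, Finset.mul_sum,
    realCorrelation_diagonalProductState_mulVec]
  refine Finset.sum_le_sum fun k _ => ?_
  have h1 : c ^ 2 ≤ l k ^ 2 := by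
    rw [← sq_abs (l k)]
    exact pow_le_pow_left₀ hc (hl k) 2
  nlinarith [mul_nonneg (sub_nonneg.mpr h1) (sq_nonneg (w (k, 0))),
    mul_nonneg (sub_nonneg.mpr h1) (sq_nonneg (w (k, 1)))]

lemma traceNorm_zero : traceNorm (0 : Op n) = 0 := by
  simp [traceNorm]

lemma map_sub_correlationMatrix {ρ : Op n} (hρ : ρ.IsHermitian)
    (G : Matrix (Label n) (Label n) ℝ) :
    G.map (fun r : ℝ => (r : ℂ)) - correlationMatrix ρ =
      (G - realCorrelation ρ).map (fun r : ℝ => (r : ℂ)) := by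
  rw [← map_realCorrelation hρ]
  ext μ ν
  simp

lemma nonempty_label (hn : 1 ≤ n) : Nonempty (Label n) := ⟨(⟨0, hn⟩, 0)⟩

/-- An accurate estimate of the correlation matrix of a state close to a free-fermionic state has
no small singular values, if one of the two states is pure. -/
lemma one_sub_le_minSingularValue (hn : 1 ≤ n) {ρ σ : Op n} (hρ : IsState ρ)
    (hσ : σ ∈ freeMixed n) (hpure : IsPure ρ ∨ IsPure σ) {ε s t : ℝ}
    (hε : traceNorm (ρ - σ) ≤ ε) (hs : 0 ≤ s) {G : Matrix (Label n) (Label n) ℝ}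
    (hG : opNorm (G.map (fun r : ℝ => (r : ℂ)) - correlationMatrix ρ) ≤ s)
    (hst : 2 * ε + s ≤ t) (ht : t ≤ 1) : 1 - t ≤ minSingularValue G := by
  have := nonempty_label hn
  obtain ⟨U, l, hU, hl, rfl⟩ := hσ
  have hσ := isState_conj_diagonalProductState hl hU.1
  have hX := hρ.1.1.sub hσ.1.1
  have h0 : 0 ≤ traceNorm (ρ - U * diagonalProductState l * Uᴴ) :=
    (norm_nonneg _).trans (norm_trace_unitary_mul_le hX (one_mem _))
  have hlk : ∀ k, 1 - ε ≤ |l k| := fun k => by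
    rcases hpure with hp | hp
    · linarith [one_sub_traceNorm_le_abs hp hU.1 hl k]
    · have := one_sub_traceNorm_le_abs hp hU.1 hl k
      rw [sub_self, traceNorm_zero] at this
      linarith
  rw [le_minSingularValue_iff G (by linarith)]
  intro v
  have hvv := dotProduct_self_nonneg v
  have h1 := sq_mul_le_realCorrelation_mulVec hU (by linarith) hlk v
  have h2 : (realCorrelation (ρ - U * diagonalProductState l * Uᴴ) *ᵥ v) ⬝ᵥ
      (realCorrelation (ρ - U * diagonalProductState l * Uᴴ) *ᵥ v) ≤ ε ^ 2 * (v ⬝ᵥ v) :=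
    (realCorrelation_mulVec_sq_le hX v).trans
      (mul_le_mul_of_nonneg_right (pow_le_pow_left₀ h0 hε 2) hvv)
  rw [map_sub_correlationMatrix hρ.1.1, opNorm_map_ofReal_le_iff _ hs] at hG
  -- The lower bound `1 - ε` for `Γ(σ)` loses another `ε` in passing to `Γ(ρ)`, then `s` in passing
  -- to `G`.
  have h3 := sub_sq_mul_le_dotProduct_add hvv (h0.trans hε) (by linarith) h1 h2
  have h4 := sub_sq_mul_le_dotProduct_add hvv hs (by linarith) h3 (hG v)
  rw [← add_mulVec, ← add_mulVec, realCorrelation_sub, add_sub_cancel, add_sub_cancel] at h4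
  refine le_trans ?_ h4
  refine mul_le_mul_of_nonneg_right (pow_le_pow_left₀ (by linarith) (by linarith) 2) hvv

end CloseStates

/-! ### Normal form of anti-symmetric operators -/

noncomputable section NormalForm

/-- Half of the normal form of an anti-symmetric operator: an orthonormal basis of pairs on each of
which the operator has a large off-diagonal entry. -/
lemma exists_orthonormal_pairs {E : Type*} [NormedAddCommGroup E] [InnerProductSpace ℝ E]
    [FiniteDimensional ℝ E] (T : E →ₗ[ℝ] E) (hT : ∀ v w, inner ℝ (T v) w = -inner ℝ v (T w))
    {c : ℝ} (hc : 0 < c) (hTc : ∀ v, c * ‖v‖ ≤ ‖T v‖) (k : ℕ) (S : Submodule ℝ E)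
    (hS : Module.finrank ℝ S = 2 * k) (hTS : ∀ v ∈ S, T v ∈ S) :
    ∃ e : Fin k × Fin 2 → E, Orthonormal ℝ e ∧ (∀ p, e p ∈ S) ∧
      ∀ i, c ≤ inner ℝ (e (i, 0)) (T (e (i, 1))) := by
  induction k generalizing S with
  | zero => exact ⟨fun p => p.1.elim0, ⟨fun p => p.1.elim0, fun p => p.1.elim0⟩,
      fun p => p.1.elim0, fun i => i.elim0⟩
  | succ k ih =>
    have hsymm : (T ∘ₗ T).IsSymmetric := fun v w => by
      simp only [LinearMap.comp_apply, hT, neg_neg]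
    have hinv : ∀ v ∈ S, (T ∘ₗ T) v ∈ S := fun v hv => hTS _ (hTS _ hv)
    have : Nontrivial S := Module.nontrivial_of_finrank_pos (R := ℝ) (by omega)
    -- `T²` is symmetric, so it has a real eigenvector `u` in `S`. The span of `u` and `T u` is then
    -- `T`-invariant, and by anti-symmetry so is its complement in `S`, to which induction applies.
    obtain ⟨u, hu⟩ := (hsymm.restrict_invariant hinv).hasEigenvalue_iSup_of_finiteDimensional
      |>.exists_hasEigenvector
    obtain ⟨m, hm⟩ : ∃ m : ℝ, T (T (u : E)) = m • (u : E) :=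
      ⟨_, congrArg Subtype.val hu.apply_eq_smul⟩
    have hu0 : (u : E) ≠ 0 := fun h => hu.2 (Subtype.ext h)
    set v : E := ‖(u : E)‖⁻¹ • (u : E) with hv
    have hvS : v ∈ S := S.smul_mem _ u.2
    have hv1 : ‖v‖ = 1 := norm_smul_inv_norm hu0
    have hTTv : T (T v) = m • v := by
      rw [hv, map_smul, map_smul, hm, smul_comm]
    have hlam : c ≤ ‖T v‖ := by simpa [hv1] using hTc v
    have hlam0 : 0 < ‖T v‖ := hc.trans_le hlam
    -- Listing the image of `v` first makes the entry equal to `+‖T v‖`, so no sign has to be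
    -- adjusted.
    set f : Fin 2 → E := ![‖T v‖⁻¹ • T v, v] with hf
    have hTvv : inner ℝ (T v) v = 0 := by
      have h := hT v v
      rw [real_inner_comm (T v) v] at h
      linarith
    have hfon : Orthonormal ℝ f := by
      rw [orthonormal_iff_ite]
      have hw : ‖‖T v‖⁻¹ • T v‖ = 1 := norm_smul_inv_norm (norm_pos_iff.mp hlam0)
      intro i j
      fin_cases i <;> fin_cases j
      · simp only [hf, Fin.zero_eta, cons_val_zero]
        rw [real_inner_self_eq_norm_sq, hw]; simp
      · simp [hf, real_inner_smul_left, hTvv]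
      · simp [hf, real_inner_smul_right, real_inner_comm v (T v) ▸ hTvv]
      · simp [hf, hv1]
    have hfS : ∀ i, f i ∈ S := fun i => by
      fin_cases i
      · exact S.smul_mem _ (hTS _ hvS)
      · exact hvS
    set K := Submodule.span ℝ (Set.range f) with hK
    have hKS : K ≤ S := Submodule.span_le.mpr (by rintro _ ⟨i, rfl⟩; exact hfS i)
    have hKfin : Module.finrank ℝ K = 2 := by
      rw [hK, finrank_span_eq_card hfon.linearIndependent, Fintype.card_fin]
    have hperp : ∀ x, x ∈ Kᗮ ↔ inner ℝ v x = 0 ∧ inner ℝ (T v) x = 0 := fun x => by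
      have h1 : x ∈ Kᗮ ↔ ∀ i, inner ℝ (f i) x = 0 := by
        rw [Submodule.mem_orthogonal]
        constructor
        · exact fun h i => h _ (Submodule.subset_span ⟨i, rfl⟩)
        · intro h y hy
          induction hy using Submodule.span_induction with
          | mem y hy => obtain ⟨i, rfl⟩ := hy; exact h i
          | zero => simp
          | add a b _ _ ha hb => rw [inner_add_left, ha, hb, add_zero]
          | smul r a _ ha => rw [real_inner_smul_left, ha, mul_zero]
      rw [h1, Fin.forall_fin_two]
      simp [hf, real_inner_smul_left, hlam0.ne', and_comm]
    obtain ⟨e, he, heS, hec⟩ := ih (Kᗮ ⊓ S)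
      (by have := Submodule.finrank_add_inf_finrank_orthogonal hKS; omega)
      (fun x hx => by
        obtain ⟨hx1, hx2⟩ := hx
        obtain ⟨hx3, hx4⟩ := (hperp x).mp hx1
        refine ⟨(hperp _).mpr ⟨?_, ?_⟩, hTS _ hx2⟩
        · have := hT v x
          linarith
        · have := hT (T v) x
          rw [hTTv, real_inner_smul_left, hx3, mul_zero] at this
          linarith)
    have hef : ∀ p i, inner ℝ (f i) (e p) = 0 := fun p i =>
      (Submodule.mem_orthogonal K _).mp (heS p).1 _ (Submodule.subset_span ⟨i, rfl⟩)
    refine ⟨fun p => Fin.cases (f p.2) (fun i => e (i, p.2)) p.1, ?_, ?_, ?_⟩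
    · rw [orthonormal_iff_ite] at hfon he ⊢
      rintro ⟨i, s⟩ ⟨j, t⟩
      refine Fin.cases ?_ (fun i => ?_) i <;> refine Fin.cases ?_ (fun j => ?_) j
      · simpa using hfon s t
      · simp [hef, (Fin.succ_ne_zero j).symm]
      · simp [real_inner_comm (f t), hef]
      · simpa using he (i, s) (j, t)
    · rintro ⟨i, s⟩
      refine Fin.cases ?_ (fun i => ?_) i
      · exact hfS s
      · exact (heS (i, s)).2
    · intro i
      refine Fin.cases ?_ (fun i => ?_) i
      · simp only [Fin.cases_zero, hf, cons_val_zero, cons_val_one, real_inner_smul_left,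
          real_inner_self_eq_norm_sq]
        rw [pow_two, inv_mul_cancel_left₀ hlam0.ne']
        exact hlam
      · exact hec i

variable {n : ℕ}

lemma exists_frame_of_antisymm {A : Matrix (Label n) (Label n) ℝ} (hA : Aᵀ = -A) {c : ℝ}
    (hc : 0 < c) (hAc : ∀ v, c ^ 2 * (v ⬝ᵥ v) ≤ (A *ᵥ v) ⬝ᵥ (A *ᵥ v)) :
    ∃ e : Label n → Label n → ℝ, (∀ μ ν, e μ ⬝ᵥ e ν = if μ = ν then 1 else 0) ∧
      ∀ k, c ≤ e (k, 0) ⬝ᵥ (A *ᵥ e (k, 1)) := by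
  have hinner : ∀ v w : EuclideanSpace ℝ (Label n), inner ℝ v w = v.ofLp ⬝ᵥ w.ofLp := fun v w => by
    rw [EuclideanSpace.inner_eq_star_dotProduct, dotProduct_comm, star_trivial]
  have hnorm : ∀ v : EuclideanSpace ℝ (Label n), ‖v‖ ^ 2 = v.ofLp ⬝ᵥ v.ofLp := fun v => by
    rw [← real_inner_self_eq_norm_sq, hinner]
  obtain ⟨e, he, -, hec⟩ := exists_orthonormal_pairs (E := EuclideanSpace ℝ (Label n))
    (toEuclideanLin A) (fun v w => by
      rw [hinner, hinner, toLpLin_apply, toLpLin_apply, dotProduct_mulVec, ← mulVec_transpose, hA,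
        neg_mulVec, neg_dotProduct, neg_neg]) hc
    (fun v => by
      refine le_of_sq_le_sq ?_ (norm_nonneg _)
      rw [mul_pow, hnorm, hnorm]
      exact hAc v.ofLp) n ⊤ (by simp [mul_comm]) (fun _ _ => trivial)
  refine ⟨fun μ => (e μ).ofLp, fun μ ν => ?_, fun k => ?_⟩
  · rw [← hinner, orthonormal_iff_ite.mp he]
  · have := hec k
    rwa [hinner] at this

end NormalForm

/-! ### Fuchs–van de Graaf and states with large singular values (Case B) -/

noncomputable section FarStates

variable {n : ℕ}

/-- Cauchy–Schwarz for the Hilbert–Schmidt inner product, with matrices viewed as vectors indexed by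
`ι × ι`. -/
lemma re_trace_conjTranspose_mul_sq_le {ι : Type} [Fintype ι] (A B : Matrix ι ι ℂ) :
    (Aᴴ * B).trace.re ^ 2 ≤ (Aᴴ * A).trace.re * (Bᴴ * B).trace.re := by
  have htr : ∀ C D : Matrix ι ι ℂ, (Cᴴ * D).trace =
      inner ℂ (WithLp.toLp 2 (fun p : ι × ι => C p.1 p.2) : EuclideanSpace ℂ (ι × ι))
        (WithLp.toLp 2 (fun p : ι × ι => D p.1 p.2)) := fun C D => by
    rw [EuclideanSpace.inner_eq_star_dotProduct, dotProduct, Fintype.sum_prod_type, Finset.sum_comm]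
    simp [trace, mul_apply, mul_comm]
  have hre : ∀ C : Matrix ι ι ℂ, (Cᴴ * C).trace.re =
      ‖(WithLp.toLp 2 (fun p : ι × ι => C p.1 p.2) : EuclideanSpace ℂ (ι × ι))‖ ^ 2 := fun C => by
    rw [htr]
    exact inner_self_eq_norm_sq (𝕜 := ℂ) _
  rw [hre, hre, htr, ← mul_pow, ← sq_abs]
  exact pow_le_pow_left₀ (abs_nonneg _)
    ((Complex.abs_re_le_norm _).trans (norm_inner_le_norm _ _)) 2

open scoped MatrixOrder Matrix.Norms.L2Operator in
lemma exists_eq_conjTranspose_mul_self {ι : Type} [Fintype ι] [DecidableEq ι] {A : Matrix ι ι ℂ}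
    (hA : A.PosSemidef) : ∃ B, A = Bᴴ * B :=
  CStarAlgebra.nonneg_iff_eq_star_mul_self.mp hA.nonneg

/-- Distinguishing a state from a basis state by a two-outcome observable. -/
lemma re_trace_mul_sub_single_sq_le {ι : Type} [Fintype ι] [DecidableEq ι] {ρ W : Matrix ι ι ℂ}
    (hρ : ρ.PosSemidef) (hρ1 : ρ.trace = 1) (hW : W.IsHermitian) (hWW : W * W = 1) (o : ι)
    (ho : 0 < (ρ o o).re) :
    (W * (ρ - single o o 1)).trace.re ^ 2 ≤ 4 * (1 - (ρ o o).re) := by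
  obtain ⟨B, hB⟩ := exists_eq_conjTranspose_mul_self hρ
  set F := (ρ o o).re with hF
  have hFc : ρ o o = F := (Complex.conj_eq_iff_re.mp (hρ.1.apply o o)).symm
  set E : Matrix ι ι ℂ := single o o 1 with hE
  have hEH : Eᴴ = E := by rw [hE, conjTranspose_single, star_one]
  have hEρE : E * ρ * E = (F : ℂ) • E := by
    rw [hE, single_mul_mul_single, hFc]
    simp
  have hEρ : (E * ρ).trace = F := by
    rw [hE, trace_single_mul, hFc]
    simp
  set f : ℂ := (((√F)⁻¹ : ℝ) : ℂ) with hf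
  have hs0 : √F ≠ 0 := (Real.sqrt_ne_zero ho.le).mpr ho.ne'
  have hff : f * f * F = 1 := by
    rw [hf, ← Complex.ofReal_mul, ← Complex.ofReal_mul, ← mul_inv, Real.mul_self_sqrt ho.le,
      inv_mul_cancel₀ ho.ne', Complex.ofReal_one]
  have hfF : f * F = ((√F : ℝ) : ℂ) := by
    rw [hf, ← Complex.ofReal_mul]
    nth_rewrite 2 [← Real.mul_self_sqrt ho.le]
    rw [inv_mul_cancel_left₀ hs0]
  have hfstar : star f = f := Complex.conj_ofReal _
  -- `Bᴴ` is an amplitude of `ρ`, and `S` is an amplitude of `E` aligned with it: `S * Sᴴ = E`, with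
  -- overlap `Tr(B S) = √F` real and positive, as in Uhlmann's theorem.
  set S := f • (E * Bᴴ) with hS
  have hSH : Sᴴ = f • (B * E) := by
    rw [hS, conjTranspose_smul, hfstar, conjTranspose_mul, conjTranspose_conjTranspose, hEH]
  have hSS : S * Sᴴ = E := by
    rw [hSH, hS, smul_mul_smul_comm]
    have : E * Bᴴ * (B * E) = E * ρ * E := by rw [hB]; simp only [mul_assoc]
    rw [this, hEρE, smul_smul, hff, one_smul]
  have hBB : (B * Bᴴ).trace = 1 := by rw [trace_mul_comm, ← hB, hρ1]
  have hSS1 : (Sᴴ * S).trace = 1 := by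
    rw [trace_mul_comm, hSS, hE, trace_single_eq_same]
  have hBS : (B * S).trace = ((√F : ℝ) : ℂ) := by
    rw [hS, mul_smul_comm, trace_smul, trace_mul_comm, mul_assoc, ← hB, hEρ, smul_eq_mul, hfF]
  have hSB : (Sᴴ * Bᴴ).trace = ((√F : ℝ) : ℂ) := by
    rw [← conjTranspose_mul, trace_conjTranspose, hBS]
    exact Complex.conj_ofReal _
  have hcross : (Sᴴ * W * Bᴴ).trace.re = (B * W * S).trace.re := by
    have h : Sᴴ * W * Bᴴ = (B * W * S)ᴴ := by
      simp only [conjTranspose_mul, hW.eq, mul_assoc]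
    rw [h, trace_conjTranspose]
    rfl
  have hWρ : (W * ρ).trace = (B * W * Bᴴ).trace := by
    rw [hB, ← mul_assoc, trace_mul_comm, ← mul_assoc]
  have hWE : (W * E).trace = (Sᴴ * W * S).trace := by
    rw [← hSS, ← mul_assoc, trace_mul_comm, ← mul_assoc]
  -- In `Re Tr((Bᴴ - S)ᴴ W (Bᴴ + S))` the cross terms cancel, leaving `Tr(W (ρ - E))`; the two
  -- squared norms are `2 - 2√F` and `2 + 2√F`, with product `4 (1 - F)`.
  have h1 := re_trace_conjTranspose_mul_sq_le (Bᴴ - S) (W * (Bᴴ + S))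
  have h2 : ((Bᴴ - S)ᴴ * (W * (Bᴴ + S))).trace.re = (W * (ρ - E)).trace.re := by
    simp only [conjTranspose_sub, conjTranspose_conjTranspose, sub_mul, mul_add, ← mul_assoc,
      mul_sub, trace_sub, trace_add, hWρ, hWE, Complex.sub_re, Complex.add_re, hcross]
    ring
  have h3 : ((Bᴴ - S)ᴴ * (Bᴴ - S)).trace.re = 2 - 2 * √F := by
    simp only [conjTranspose_sub, conjTranspose_conjTranspose, sub_mul, mul_sub, trace_sub, hBB,
      hBS, hSB, hSS1, Complex.sub_re, Complex.one_re, Complex.ofReal_re]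
    ring
  have h4 : ((W * (Bᴴ + S))ᴴ * (W * (Bᴴ + S))).trace.re = 2 + 2 * √F := by
    have h5 : (W * (Bᴴ + S))ᴴ * (W * (Bᴴ + S)) = (Bᴴ + S)ᴴ * (W * W) * (Bᴴ + S) := by
      rw [conjTranspose_mul, hW.eq]
      simp only [mul_assoc]
    rw [h5, hWW, mul_one]
    simp only [conjTranspose_add, conjTranspose_conjTranspose, add_mul, mul_add, trace_add, hBB,
      hBS, hSB, hSS1, Complex.add_re, Complex.one_re, Complex.ofReal_re]
    ring
  rw [h2, h3, h4] at h1
  refine h1.trans_eq ?_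
  linear_combination (-4) * Real.mul_self_sqrt ho.le

/-- The Fuchs–van de Graaf inequality for a pure state. -/
lemma traceNorm_sub_sq_le {ρ U : Op n} (hρ : IsState ρ) (hU : U ∈ unitaryGroup (Basis n) ℂ)
    (o : Basis n) (ho : 0 < ((Uᴴ * ρ * U) o o).re) :
    traceNorm (ρ - U * single o o 1 * Uᴴ) ^ 2 ≤ 4 * (1 - ((Uᴴ * ρ * U) o o).re) := by
  have hUU : U * Uᴴ = 1 := mem_unitaryGroup_iff.mp hU
  have hUU' : Uᴴ * U = 1 := mem_unitaryGroup_iff'.mp hU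
  have hE : (single o o (1 : ℂ) : Op n).IsHermitian := by
    rw [IsHermitian, conjTranspose_single, star_one]
  have hX : (ρ - U * single o o 1 * Uᴴ).IsHermitian :=
    hρ.1.1.sub (isHermitian_mul_mul_conjTranspose U hE)
  obtain ⟨W, hW, hWH, hWt⟩ := exists_unitary_trace_mul_eq_traceNorm hX
  have hWW : W * W = 1 := by
    have := mem_unitaryGroup_iff.mp hW
    rwa [star_eq_conjTranspose, hWH.eq] at this
  have h1 := re_trace_mul_sub_single_sq_le (hρ.1.conjTranspose_mul_mul_same U)
    (by rw [mul_assoc, trace_mul_comm, mul_assoc, hUU, mul_one, hρ.2])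
    (W := Uᴴ * W * U) (isHermitian_conjTranspose_mul_mul U hWH)
    (by
      calc Uᴴ * W * U * (Uᴴ * W * U) = Uᴴ * W * (U * Uᴴ) * W * U := by simp only [mul_assoc]
        _ = Uᴴ * (W * W) * U := by rw [hUU, mul_one]; simp only [mul_assoc]
        _ = 1 := by rw [hWW, mul_one, hUU']) o ho
  have h2 : (Uᴴ * W * U * (Uᴴ * ρ * U - single o o 1)).trace =
      (traceNorm (ρ - U * single o o 1 * Uᴴ) : ℂ) := by
    rw [← hWt]
    calc _ = (Uᴴ * W * U * (Uᴴ * (ρ - U * single o o 1 * Uᴴ) * U)).trace := by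
          congr 2
          rw [mul_sub, sub_mul]
          congr 1
          calc single o o (1 : ℂ) = (Uᴴ * U) * single o o 1 * (Uᴴ * U) := by
                rw [hUU', one_mul, mul_one]
            _ = _ := by simp only [mul_assoc]
      _ = (Uᴴ * (W * (U * Uᴴ) * (ρ - U * single o o 1 * Uᴴ) * U)).trace := by
          simp only [mul_assoc]
      _ = _ := by
          rw [trace_mul_comm, hUU, mul_one, mul_assoc, hUU, mul_one]
  rw [h2, Complex.ofReal_re] at h1
  exact h1

lemma diagonalProductState_one :
    diagonalProductState (fun _ : Fin n => (1 : ℝ)) = single 0 0 1 := by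
  rw [diagonalProductState_eq, ← diagonal_single]
  congr 1
  ext1 x
  by_cases h : x = 0
  · subst h
    simp [productWeight, bitSign]
  · obtain ⟨j, hj⟩ := Function.ne_iff.mp h
    rw [Pi.single_eq_of_ne h, productWeight, Finset.prod_eq_zero (Finset.mem_univ j)]
    · simp
    · simp only [Pi.zero_apply] at hj
      simp [bitSign, hj]

lemma conj_single_mem_freePure {U : Op n} (hU : IsFreeFermionicUnitary U) :
    U * single 0 0 1 * Uᴴ ∈ freePure n := by
  have hl : ∀ _ : Fin n, (1 : ℝ) ∈ Set.Icc (-1 : ℝ) 1 := fun _ => by norm_num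
  rw [← diagonalProductState_one]
  refine ⟨⟨U, _, hU, hl, rfl⟩, isState_conj_diagonalProductState hl hU.1, ?_⟩
  have hUU : U * Uᴴ = 1 := mem_unitaryGroup_iff.mp hU.1
  have hdet : IsUnit U.det := isUnit_det_of_right_inverse hUU
  have hdet' : IsUnit Uᴴ.det := isUnit_det_of_left_inverse hUU
  rw [rank_mul_eq_left_of_isUnit_det _ _ hdet', rank_mul_eq_right_of_isUnit_det _ _ hdet,
    diagonalProductState_one, ← diagonal_single, rank_diagonal, Fintype.card_eq_one_iff]
  refine ⟨⟨0, by simp⟩, fun ⟨x, hx⟩ => Subtype.ext ?_⟩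
  by_contra h
  exact hx (Pi.single_eq_of_ne h 1)

/-- A union bound: if every bit is zero with high probability, so is the whole string. -/
lemma one_sub_apply_zero_le {p : Basis n → ℝ} (hp : ∀ x, 0 ≤ p x) (hp1 : ∑ x, p x = 1) :
    1 - p 0 ≤ ∑ k, (1 - ∑ x, bitSign (x k) * p x) / 2 := by
  have h1 : ∀ k : Fin n, (1 - ∑ x, bitSign (x k) * p x) / 2 =
      ∑ x, (1 - bitSign (x k)) / 2 * p x := fun k => by
    have h2 : 1 - ∑ x, bitSign (x k) * p x = ∑ x, (p x - bitSign (x k) * p x) := by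
      rw [Finset.sum_sub_distrib, hp1]
    rw [h2, Finset.sum_div]
    exact Finset.sum_congr rfl fun x _ => by ring
  have hb : ∀ b, 0 ≤ (1 - bitSign b) / 2 := fun b => by linarith [(bitSign_mem_Icc b).2]
  simp only [h1]
  have h0 : 1 - p 0 = ∑ x ∈ Finset.univ.erase 0, p x := by
    rw [← hp1, ← Finset.add_sum_erase _ _ (Finset.mem_univ (0 : Basis n)), add_sub_cancel_left]
  rw [Finset.sum_comm, h0, ← Finset.add_sum_erase _ (fun x => ∑ k : Fin n, _)
      (Finset.mem_univ (0 : Basis n))]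
  refine le_add_of_nonneg_of_le
    (Finset.sum_nonneg fun k _ => mul_nonneg (hb _) (hp _)) (Finset.sum_le_sum fun x hx => ?_)
  obtain ⟨j, hj⟩ := Function.ne_iff.mp (Finset.ne_of_mem_erase hx)
  rw [← Finset.sum_mul]
  refine le_mul_of_one_le_left (hp x) ?_
  refine le_trans ?_ (Finset.single_le_sum (fun k _ => hb (x k)) (Finset.mem_univ j))
  simp only [Pi.zero_apply] at hj
  norm_num [bitSign, hj]

/-- If an accurate estimate of the correlation matrix has no small singular values, then the state
is close to a pure free-fermionic state. -/
lemma exists_mem_freePure_traceNorm_sub_sq_le (hn : 1 ≤ n) {ρ : Op n} (hρ : IsState ρ) {s t : ℝ}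
    (hs : 0 ≤ s) {G : Matrix (Label n) (Label n) ℝ}
    (hG : opNorm (G.map (fun r : ℝ => (r : ℂ)) - correlationMatrix ρ) ≤ s)
    (hGt : 1 - t ≤ minSingularValue G) (hst : t + s < 1) (hst' : n * (t + s) < 2) :
    ∃ σ ∈ freePure n, traceNorm (ρ - σ) ^ 2 ≤ 2 * n * (t + s) := by
  have := nonempty_label hn
  rw [le_minSingularValue_iff G (by linarith)] at hGt
  rw [map_sub_correlationMatrix hρ.1.1, opNorm_map_ofReal_le_iff _ hs] at hG
  have h1 : ∀ v, (1 - (t + s)) ^ 2 * (v ⬝ᵥ v) ≤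
      (realCorrelation ρ *ᵥ v) ⬝ᵥ (realCorrelation ρ *ᵥ v) := fun v => by
    have h2 : (-((G - realCorrelation ρ) *ᵥ v)) ⬝ᵥ (-((G - realCorrelation ρ) *ᵥ v)) ≤
        s ^ 2 * (v ⬝ᵥ v) := by
      rw [neg_dotProduct_neg]
      exact hG v
    have h3 := sub_sq_mul_le_dotProduct_add (dotProduct_self_nonneg v) hs (by linarith) (hGt v) h2
    rw [← sub_eq_add_neg, ← sub_mulVec, sub_sub_cancel] at h3
    rwa [← sub_sub]
  obtain ⟨e, he, hec⟩ := exists_frame_of_antisymm (realCorrelation_transpose ρ) (by linarith) h1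
  obtain ⟨U, hU, hUe⟩ := exists_freeFermionicUnitary he
  have hUU : U * Uᴴ = 1 := mem_unitaryGroup_iff.mp hU.1
  set p : Basis n → ℝ := fun x => ((Uᴴ * ρ * U) x x).re with hp
  have hp0 : ∀ x, 0 ≤ p x := fun x =>
    (Complex.nonneg_iff.mp ((hρ.1.conjTranspose_mul_mul_same U).diag_nonneg (i := x))).1
  have hp1 : ∑ x, p x = 1 := by
    have h5 : (Uᴴ * ρ * U).trace = 1 := by
      rw [mul_assoc, trace_mul_comm, mul_assoc, hUU, mul_one, hρ.2]
    have := congrArg Complex.re h5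
    simpa [trace] using this
  -- `p` is the computational-basis distribution of `Uᴴ * ρ * U`. Each bit equals one with
  -- probability at most `(t + s) / 2`.
  have h2 : 1 - p 0 ≤ n * (t + s) / 2 := by
    refine (one_sub_apply_zero_le hp0 hp1).trans ?_
    calc ∑ k : Fin n, (1 - ∑ x, bitSign (x k) * p x) / 2 ≤ ∑ _k : Fin n, (t + s) / 2 := by
          refine Finset.sum_le_sum fun k _ => ?_
          have := hec k
          rw [realCorrelation_eq_sum_bitSign ρ he hU.1 hUe] at this
          linarith
      _ = _ := by simp; ring
  refine ⟨_, conj_single_mem_freePure hU, ?_⟩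
  -- `hst'` makes the fidelity `p 0` positive, so its square root can be inverted.
  have h3 := traceNorm_sub_sq_le hρ hU.1 0 (show 0 < p 0 by linarith)
  change _ ≤ 4 * (1 - p 0) at h3
  linarith

end FarStates

/-! ### Hoeffding bounds for finite product distributions -/

noncomputable section Concentration

/-- Hoeffding's lemma for a finite distribution. -/
lemma sum_mul_exp_le {α : Type} [Fintype α] {p f : α → ℝ} (hp : ∀ a, 0 ≤ p a)
    (hp1 : ∑ a, p a = 1) (hf : ∀ a, f a ∈ Set.Icc (-1 : ℝ) 1) (t : ℝ) :
    ∑ a, p a * Real.exp (t * (f a - ∑ b, p b * f b)) ≤ Real.exp (t ^ 2 / 2) := by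
  let _ : MeasurableSpace α := ⊤
  have : MeasurableSingletonClass α := ⟨fun _ => trivial⟩
  set P : PMF α := PMF.ofFintype (fun a => ENNReal.ofReal (p a)) (by
    rw [← ENNReal.ofReal_sum_of_nonneg (fun a _ => hp a), hp1, ENNReal.ofReal_one]) with hP
  have hint : ∀ g : α → ℝ, ∫ a, g a ∂P.toMeasure = ∑ a, p a * g a := fun g => by
    rw [PMF.integral_eq_sum]
    simp [hP, ENNReal.toReal_ofReal, hp]
  -- An interval of length two gives sub-Gaussian parameter `(2 / 2)² = 1`.
  have h := ProbabilityTheory.hasSubgaussianMGF_of_mem_Icc (μ := P.toMeasure) (X := f)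
    (measurable_from_top.aemeasurable) (Filter.Eventually.of_forall hf)
  have h1 := h.mgf_le t
  rw [ProbabilityTheory.mgf, hint, hint] at h1
  refine h1.trans_eq ?_
  norm_num

variable {N K : ℕ}

/-- The probability of an event under a product of finite distributions. -/
def productProb (q : Fin N → Fin K → ℝ) (E : Set (Fin N → Fin K)) : ℝ :=
  ∑ x, E.indicator (fun x => ∏ m, q m (x m)) x

lemma sum_prod_mul_prod (q g : Fin N → Fin K → ℝ) :
    ∑ x : Fin N → Fin K, (∏ m, q m (x m)) * ∏ m, g m (x m) = ∏ m, ∑ a, q m a * g m a := by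
  rw [Finset.prod_univ_sum, Fintype.piFinset_univ]
  simp only [Finset.prod_mul_distrib]

lemma productProb_mono {q : Fin N → Fin K → ℝ} (hq : ∀ m a, 0 ≤ q m a)
    {E F : Set (Fin N → Fin K)} (h : E ⊆ F) : productProb q E ≤ productProb q F :=
  Finset.sum_le_sum fun x _ => Set.indicator_le_indicator_of_subset h
    (fun x => Finset.prod_nonneg fun m _ => hq m (x m)) x

lemma productProb_univ {q : Fin N → Fin K → ℝ} (hq1 : ∀ m, ∑ a, q m a = 1) :
    productProb q Set.univ = 1 := by
  have h := sum_prod_mul_prod q fun _ _ => 1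
  simpa [productProb, hq1] using h

lemma productProb_add_compl (q : Fin N → Fin K → ℝ) (E : Set (Fin N → Fin K)) :
    productProb q E + productProb q Eᶜ = productProb q Set.univ := by
  simp only [productProb, ← Finset.sum_add_distrib]
  refine Finset.sum_congr rfl fun x _ => ?_
  rw [Set.indicator_univ]
  exact congrFun (Set.indicator_self_add_compl E _) x

lemma productProb_iUnion_le {ι : Type} [Fintype ι] {q : Fin N → Fin K → ℝ} (hq : ∀ m a, 0 ≤ q m a)
    (E : ι → Set (Fin N → Fin K)) :
    productProb q (⋃ i, E i) ≤ ∑ i, productProb q (E i) := by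
  simp only [productProb]
  rw [Finset.sum_comm]
  refine Finset.sum_le_sum fun x _ => ?_
  have h0 : 0 ≤ ∏ m, q m (x m) := Finset.prod_nonneg fun m _ => hq m (x m)
  have hnn : ∀ i, 0 ≤ (E i).indicator (fun x => ∏ m, q m (x m)) x := fun i =>
    Set.indicator_apply_nonneg fun _ => h0
  by_cases hx : x ∈ ⋃ i, E i
  · obtain ⟨i, hi⟩ := Set.mem_iUnion.mp hx
    rw [Set.indicator_of_mem hx]
    refine le_trans ?_ (Finset.single_le_sum (fun i _ => hnn i) (Finset.mem_univ i))
    rw [Set.indicator_of_mem hi]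
  · rw [Set.indicator_of_notMem hx]
    exact Finset.sum_nonneg fun i _ => hnn i

/-- Hoeffding's inequality for the average over a set of copies. -/
lemma productProb_lt_average_sub_le {q : Fin N → Fin K → ℝ} (hq : ∀ m a, 0 ≤ q m a)
    (hq1 : ∀ m, ∑ a, q m a = 1) {S : Finset (Fin N)} (hS : 0 < S.card) {f : Fin K → ℝ}
    (hf : ∀ a, f a ∈ Set.Icc (-1 : ℝ) 1) {c : ℝ} (hc : ∀ m ∈ S, ∑ a, q m a * f a = c) {t : ℝ}
    (ht : 0 ≤ t) :
    productProb q {x | t < (S.card : ℝ)⁻¹ * ∑ m ∈ S, f (x m) - c} ≤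
      Real.exp (-(S.card * t ^ 2 / 2)) := by
  set s : ℝ := (S.card : ℝ) with hs
  have hs0 : 0 < s := Nat.cast_pos.mpr hS
  -- Chernoff's pointwise bound with exponential parameter `t` itself, which minimises `-λ s t + s
  -- λ² / 2` over `λ`.
  have h1 : ∀ x : Fin N → Fin K,
      Set.indicator {x | t < s⁻¹ * ∑ m ∈ S, f (x m) - c} (fun x => ∏ m, q m (x m)) x ≤
      Real.exp (-(s * t ^ 2)) *
        ((∏ m, q m (x m)) * ∏ m, (if m ∈ S then Real.exp (t * (f (x m) - c)) else 1)) := fun x => by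
    have h0 : 0 ≤ ∏ m, q m (x m) := Finset.prod_nonneg fun m _ => hq m (x m)
    have hprod : ∏ m, (if m ∈ S then Real.exp (t * (f (x m) - c)) else 1) =
        Real.exp (t * (∑ m ∈ S, f (x m) - s * c)) := by
      rw [Finset.prod_ite_mem, Finset.univ_inter, ← Real.exp_sum, ← Finset.mul_sum,
        Finset.sum_sub_distrib, Finset.sum_const, nsmul_eq_mul]
    rw [hprod]
    by_cases hx : x ∈ {x | t < s⁻¹ * ∑ m ∈ S, f (x m) - c}
    · rw [Set.indicator_of_mem hx, mul_left_comm, ← Real.exp_add]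
      refine le_mul_of_one_le_right h0 (Real.one_le_exp ?_)
      have h2 : t * s ≤ ∑ m ∈ S, f (x m) - s * c := by
        have h3 := mul_le_mul_of_nonneg_left (le_of_lt hx) hs0.le
        rw [mul_sub, mul_inv_cancel_left₀ hs0.ne'] at h3
        linarith
      nlinarith [mul_le_mul_of_nonneg_left h2 ht]
    · rw [Set.indicator_of_notMem hx]
      positivity
  have h2 : ∀ m, ∑ a, q m a * (if m ∈ S then Real.exp (t * (f a - c)) else 1) ≤
      if m ∈ S then Real.exp (t ^ 2 / 2) else 1 := fun m => by
    split_ifs with hm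
    · have := sum_mul_exp_le (hq m) (hq1 m) hf t
      rwa [hc m hm] at this
    · simp [hq1]
  calc productProb q {x | t < s⁻¹ * ∑ m ∈ S, f (x m) - c}
      ≤ ∑ x : Fin N → Fin K, Real.exp (-(s * t ^ 2)) * ((∏ m, q m (x m)) *
          ∏ m, (if m ∈ S then Real.exp (t * (f (x m) - c)) else 1)) :=
        Finset.sum_le_sum fun x _ => h1 x
    _ = Real.exp (-(s * t ^ 2)) * ∏ m, ∑ a, q m a *
          (if m ∈ S then Real.exp (t * (f a - c)) else 1) := by
        rw [← Finset.mul_sum,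
          sum_prod_mul_prod q fun m a => if m ∈ S then Real.exp (t * (f a - c)) else 1]
    _ ≤ Real.exp (-(s * t ^ 2)) * ∏ m, (if m ∈ S then Real.exp (t ^ 2 / 2) else 1) := by
        refine mul_le_mul_of_nonneg_left (Finset.prod_le_prod (fun m _ => ?_) fun m _ => h2 m)
          (Real.exp_nonneg _)
        refine Finset.sum_nonneg fun a _ => mul_nonneg (hq m a) ?_
        split_ifs <;> positivity
    _ = Real.exp (-(s * t ^ 2 / 2)) := by
        rw [Finset.prod_ite_mem, Finset.univ_inter, Finset.prod_const, ← Real.exp_nat_mul, ← hs,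
          ← Real.exp_add]
        congr 1
        ring

lemma productProb_lt_abs_average_sub_le {q : Fin N → Fin K → ℝ} (hq : ∀ m a, 0 ≤ q m a)
    (hq1 : ∀ m, ∑ a, q m a = 1) {S : Finset (Fin N)} (hS : 0 < S.card) {f : Fin K → ℝ}
    (hf : ∀ a, f a ∈ Set.Icc (-1 : ℝ) 1) {c : ℝ} (hc : ∀ m ∈ S, ∑ a, q m a * f a = c) {t : ℝ}
    (ht : 0 ≤ t) :
    productProb q {x | t < |(S.card : ℝ)⁻¹ * ∑ m ∈ S, f (x m) - c|} ≤
      2 * Real.exp (-(S.card * t ^ 2 / 2)) := by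
  have h1 := productProb_lt_average_sub_le hq hq1 hS hf hc ht
  have h2 := productProb_lt_average_sub_le hq hq1 hS (f := fun a => -f a) (c := -c)
    (fun a => ⟨by linarith [(hf a).2], by linarith [(hf a).1]⟩)
    (fun m hm => by simp [← hc m hm]) ht
  have h3 : {x : Fin N → Fin K | t < |(S.card : ℝ)⁻¹ * ∑ m ∈ S, f (x m) - c|} ⊆
      ⋃ b : Bool, bif b then {x | t < (S.card : ℝ)⁻¹ * ∑ m ∈ S, f (x m) - c}
        else {x | t < (S.card : ℝ)⁻¹ * ∑ m ∈ S, -f (x m) - -c} := fun x hx => by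
    rcases lt_abs.mp (show t < |(S.card : ℝ)⁻¹ * ∑ m ∈ S, f (x m) - c| from hx) with h | h
    · exact Set.mem_iUnion.mpr ⟨true, h⟩
    · refine Set.mem_iUnion.mpr ⟨false, ?_⟩
      simp only [cond_false, Set.mem_ofPred_eq, Finset.sum_neg_distrib]
      linarith
  have h4 := (productProb_mono hq h3).trans (productProb_iUnion_le hq _)
  rw [Fintype.sum_bool] at h4
  simp only [cond_true, cond_false] at h4
  linarith

end Concentration

/-! ### Round-robin decomposition into perfect matchings -/

section Pairings

/-- Round `d` of a round-robin tournament with players `ZMod m` and one extra player. -/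
def roundRobin {n : ℕ} (m : ℕ) (d : ZMod m) (p : Label n) : Option (ZMod m) :=
  if (p.1 : ℕ) = 0 then (if p.2 = 0 then none else some d)
  else some (if p.2 = 0 then d + (p.1 : ℕ) else d - (p.1 : ℕ))

/-- Besides the pair of the extra player and `d`, a round pairs `d + i` with `d - i` for `0 < i <
n`. A coincidence would force `i = j` or `i + j = 0` modulo `m`; the latter is impossible as `0 < i
+ j ≤ 2n - 2 < m`. -/
lemma roundRobin_injective {n m : ℕ} (hm : m + 1 = 2 * n) (d : ZMod m) :
    Function.Injective (roundRobin (n := n) m d) := by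
  have hcast : ∀ a b : ℕ, a < m → b < m → (a : ZMod m) = b → a = b := fun a b ha hb h => by
    rw [ZMod.natCast_eq_natCast_iff'] at h
    rwa [Nat.mod_eq_of_lt ha, Nat.mod_eq_of_lt hb] at h
  have hsum : ∀ a b : ℕ, a + b < m → (a : ZMod m) = -(b : ZMod m) → a = 0 ∧ b = 0 :=
    fun a b hab h => by
    have h1 : ((a + b : ℕ) : ZMod m) = (0 : ℕ) := by
      push_cast
      rw [h, neg_add_cancel]
    have := hcast _ _ hab (by omega) h1
    omega
  rintro ⟨i, s⟩ ⟨j, t⟩ h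
  have hi := i.2
  have hj := j.2
  simp only [roundRobin] at h
  rw [Prod.mk.injEq, Fin.ext_iff]
  by_cases hi0 : (i : ℕ) = 0 <;> by_cases hj0 : (j : ℕ) = 0 <;> fin_cases s <;> fin_cases t <;>
    simp [hi0, hj0, sub_eq_add_neg] at h ⊢
  all_goals first
    | (have h1 := hcast _ 0 (by omega) (by omega) (h.trans Nat.cast_zero.symm); omega)
    | (have h1 := hcast _ _ (by omega) (by omega) h; omega)
    | (have h1 := hsum _ _ (by omega) h; omega)
    | (have h1 := hsum _ _ (by omega) h.symm; omega)

/-- As `m = 2n - 1`, the inverse of `2` modulo `m` is `n`. Two ordinary players meet in the round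
`(a + b) / 2`, at offset half their difference; the extra player meets `b` in round `b`. -/
lemma exists_roundRobin_eq {n m : ℕ} (hn : 1 ≤ n) (hm : m + 1 = 2 * n) {a b : Option (ZMod m)}
    (hab : a ≠ b) : ∃ (d : ZMod m) (k : Fin n),
      (roundRobin m d (k, 0) = a ∧ roundRobin m d (k, 1) = b) ∨
      (roundRobin m d (k, 0) = b ∧ roundRobin m d (k, 1) = a) := by
  have : NeZero m := ⟨by omega⟩
  have h2n : (n : ZMod m) * 2 = 1 := by
    have : ((m + 1 : ℕ) : ZMod m) = ((2 * n : ℕ) : ZMod m) := by rw [hm]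
    push_cast at this
    rw [mul_comm, ← this, ZMod.natCast_self, zero_add]
  rcases a with _ | a <;> rcases b with _ | b
  · exact absurd rfl hab
  · exact ⟨b, ⟨0, hn⟩, Or.inl (by simp [roundRobin])⟩
  · exact ⟨a, ⟨0, hn⟩, Or.inr (by simp [roundRobin])⟩
  · have hab' : a ≠ b := fun h => hab (congrArg some h)
    set v := (n : ZMod m) * (a - b) with hv
    have hv0 : v ≠ 0 := fun h => hab' (by
      have : 2 * v = a - b := by rw [hv, ← mul_assoc, mul_comm 2, h2n, one_mul]
      rw [h, mul_zero] at this
      exact (sub_eq_zero.mp this.symm))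
    have hval : v.val ≠ 0 := fun h => hv0 ((ZMod.val_eq_zero v).mp h)
    have hlt := ZMod.val_lt v
    have hd1 : (n : ZMod m) * (a + b) + v = a := by
      rw [hv]; linear_combination a * h2n
    have hd2 : (n : ZMod m) * (a + b) - v = b := by
      rw [hv]; linear_combination b * h2n
    by_cases hc : v.val < n
    · refine ⟨(n : ZMod m) * (a + b), ⟨v.val, hc⟩, Or.inl ?_⟩
      simp [roundRobin, hv0, hd1, hd2]
    -- If the offset `v` has representative at least `n`, then `-v` has one below `n`, and the two
    -- players exchange places.
    · refine ⟨(n : ZMod m) * (a + b), ⟨m - v.val, by omega⟩, Or.inr ?_⟩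
      have hne : m - v.val ≠ 0 := by omega
      have hcast : ((m - v.val : ℕ) : ZMod m) = -v := by
        rw [Nat.cast_sub hlt.le, ZMod.natCast_self, ZMod.natCast_zmod_val, zero_sub]
      simp [roundRobin, hne, hcast, hd1, ← sub_eq_add_neg, hd2]

/-- The pairs of Majorana labels are partitioned into `2 n - 1` perfect matchings. -/
lemma exists_matchings {n : ℕ} (hn : 1 ≤ n) :
    ∃ π : Fin (2 * n - 1) → Equiv.Perm (Label n), ∀ μ ν, μ ≠ ν → ∃ d k,
      (π d (k, 0) = μ ∧ π d (k, 1) = ν) ∨ (π d (k, 0) = ν ∧ π d (k, 1) = μ) := by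
  have : NeZero (2 * n - 1) := ⟨by omega⟩
  have hm : 2 * n - 1 + 1 = 2 * n := by omega
  have hcard : Fintype.card (Label n) = Fintype.card (Option (ZMod (2 * n - 1))) := by
    rw [Fintype.card_option, ZMod.card, Fintype.card_prod, Fintype.card_fin, Fintype.card_fin]
    omega
  set g := Fintype.equivOfCardEq hcard
  have hbij : ∀ d, Function.Bijective (roundRobin (n := n) (2 * n - 1) d) := fun d =>
    (Fintype.bijective_iff_injective_and_card _).mpr ⟨roundRobin_injective hm d, hcard⟩
  refine ⟨fun d => (Equiv.ofBijective _ (hbij (ZMod.finEquiv _ d))).trans g.symm,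
    fun μ ν hμν => ?_⟩
  obtain ⟨d, k, h⟩ := exists_roundRobin_eq hn hm (g.injective.ne hμν)
  refine ⟨(ZMod.finEquiv _).symm d, k, ?_⟩
  simpa [Equiv.symm_apply_eq] using h

end Pairings

/-! ### Single-copy measurements and the estimator -/

noncomputable section Estimator

variable {n : ℕ}

/-- The measurement of all qubits in the computational basis after undoing a unitary. -/
def rotatedMeasurement (U : Op n) (hU : U ∈ unitaryGroup (Basis n) ℂ) :
    Measurement n (Fintype.card (Basis n)) where
  effect a := U * single ((Fintype.equivFin (Basis n)).symm a)
    ((Fintype.equivFin (Basis n)).symm a) 1 * Uᴴ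
  posSemidef a := by
    refine PosSemidef.mul_mul_conjTranspose_same ?_ U
    rw [← diagonal_single]
    refine PosSemidef.diagonal fun x => ?_
    rw [Pi.single_apply]
    split_ifs <;> simp
  sum_eq_one := by
    rw [← Finset.sum_mul, ← Finset.mul_sum,
      Equiv.sum_comp (Fintype.equivFin (Basis n)).symm fun x => (single x x 1 : Op n)]
    have h : ∑ x, (single x x 1 : Op n) = 1 := by
      ext x y
      by_cases h : x = y
      · subst h
        simp [Matrix.sum_apply, single_apply]
      · rw [Matrix.sum_apply, one_apply_ne h]
        refine Finset.sum_eq_zero fun z _ => ?_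
        rw [single_apply, if_neg]
        rintro ⟨rfl, rfl⟩
        exact h rfl
    rw [h, mul_one]
    exact mem_unitaryGroup_iff.mp hU

lemma rotatedMeasurement_outcomeProb {U : Op n} (hU : U ∈ unitaryGroup (Basis n) ℂ) (ρ : Op n)
    (a : Fin (Fintype.card (Basis n))) : (rotatedMeasurement U hU).outcomeProb ρ a =
      ((Uᴴ * ρ * U) ((Fintype.equivFin (Basis n)).symm a)
        ((Fintype.equivFin (Basis n)).symm a)).re := by
  change (U * single _ _ 1 * Uᴴ * ρ).trace.re = _
  generalize (Fintype.equivFin (Basis n)).symm a = x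
  have h : (U * single x x 1 * Uᴴ * ρ).trace = (single x x 1 * (Uᴴ * ρ * U)).trace := by
    rw [mul_assoc, mul_assoc, trace_mul_comm]
    simp only [mul_assoc]
  rw [h, trace_single_mul]
  simp

lemma Measurement.outcomeProb_nonneg {K : ℕ} (M : Measurement n K) {ρ : Op n} (hρ : IsState ρ)
    (a : Fin K) : 0 ≤ M.outcomeProb ρ a := by
  obtain ⟨B, hB⟩ := exists_eq_conjTranspose_mul_self hρ.1
  have h : (M.effect a * ρ).trace = (B * M.effect a * Bᴴ).trace := by
    rw [hB, ← mul_assoc, trace_mul_comm, ← mul_assoc]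
  rw [Measurement.outcomeProb, h]
  exact (Complex.nonneg_iff.mp ((M.posSemidef a).mul_mul_conjTranspose_same B).trace_nonneg).1

lemma Measurement.sum_outcomeProb {K : ℕ} (M : Measurement n K) {ρ : Op n} (hρ : IsState ρ) :
    ∑ a, M.outcomeProb ρ a = 1 := by
  simp only [Measurement.outcomeProb]
  rw [← Complex.re_sum, ← trace_sum, ← Finset.sum_mul, M.sum_eq_one, one_mul, hρ.2,
    Complex.one_re]

/-- The value `±1` that an outcome of a computational basis measurement assigns to a qubit. -/
def outcomeSign (k : Fin n) (a : Fin (Fintype.card (Basis n))) : ℝ :=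
  bitSign ((Fintype.equivFin (Basis n)).symm a k)

/-- For every permutation of the Majorana operators there is a measurement whose outcomes are
unbiased estimates of the correlations of all pairs `π (k, 0)`, `π (k, 1)`. -/
lemma exists_measurement (π : Equiv.Perm (Label n)) :
    ∃ M : Measurement n (Fintype.card (Basis n)), ∀ (ρ : Op n) (k : Fin n),
      ∑ a, M.outcomeProb ρ a * outcomeSign k a = realCorrelation ρ (π (k, 0)) (π (k, 1)) := by
  -- Permuted standard vectors form an orthonormal frame, whose pairs become the standard modes and
  -- hence the `Z_k`.
  have he : ∀ μ ν, (Pi.single (π μ) 1 : Label n → ℝ) ⬝ᵥ Pi.single (π ν) 1 =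
      if μ = ν then 1 else 0 := fun μ ν => by
    simp [Pi.single_apply, eq_comm]
  obtain ⟨U, hU, hUe⟩ := exists_freeFermionicUnitary he
  refine ⟨rotatedMeasurement U hU.1, fun ρ k => ?_⟩
  have h := realCorrelation_eq_sum_bitSign ρ he hU.1 hUe k
  simp only [mulVec_single_one, single_one_dotProduct, col_apply] at h
  rw [h, ← Equiv.sum_comp (Fintype.equivFin (Basis n)).symm]
  refine Finset.sum_congr rfl fun a _ => ?_
  rw [rotatedMeasurement_outcomeProb, mul_comm]
  rfl

/-- The round of a tournament to which a copy is assigned. -/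
def copyRound {N m : ℕ} (hm : 0 < m) (i : Fin N) : Fin m := ⟨i % m, Nat.mod_lt _ hm⟩

/-- The copies that are assigned to a given round. -/
def copiesOf {N m : ℕ} (hm : 0 < m) (d : Fin m) : Finset (Fin N) :=
  Finset.univ.filter fun i => copyRound hm i = d

/-- Copies are dealt to the rounds cyclically, so round `d` receives at least the copies `j * m + d`
with `j < N / m`. -/
lemma div_le_card_copiesOf {N m : ℕ} (hm : 0 < m) (d : Fin m) :
    N / m ≤ (copiesOf (N := N) hm d).card := by
  have hlt : ∀ j : Fin (N / m), (j : ℕ) * m + d < N := fun j => by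
    calc (j : ℕ) * m + d < (j : ℕ) * m + m := by have := d.2; omega
      _ = (j + 1) * m := by ring
      _ ≤ N / m * m := Nat.mul_le_mul_right m j.2
      _ ≤ N := Nat.div_mul_le_self N m
  rw [← Fintype.card_fin (N / m), ← Finset.card_univ]
  refine Finset.card_le_card_of_injOn (fun j => ⟨j * m + d, hlt j⟩) (fun j _ => ?_) ?_
  · simp [copiesOf, copyRound, Fin.ext_iff, Nat.mod_eq_of_lt d.2]
  · intro i _ j _ h
    have h1 : (i : ℕ) * m + d = j * m + d := congrArg Fin.val h
    exact Fin.ext (Nat.eq_of_mul_eq_mul_right hm (by omega))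

/-- The average value found for qubit `k` in round `d`. -/
def roundAverage {N m : ℕ} (hm : 0 < m) (d : Fin m) (k : Fin n)
    (x : Fin N → Fin (Fintype.card (Basis n))) : ℝ :=
  ((copiesOf (N := N) hm d).card : ℝ)⁻¹ * ∑ i ∈ copiesOf hm d, outcomeSign k (x i)

/-- The estimator that measures each copy as its round prescribes and reads off each entry of the
correlation matrix, up to the factor `c`, from qubit `k` in round `D`. -/
def roundEstimator {m : ℕ} (N : ℕ) (hm : 0 < m)
    (M : Fin m → Measurement n (Fintype.card (Basis n))) (D : Label n → Label n → Fin m)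
    (k : Label n → Label n → Fin n) (c : Label n → Label n → ℝ) :
    CorrelationEstimator n N (Fintype.card (Basis n)) where
  measurement i := M (copyRound hm i)
  -- `D`, `k` and `c` for `(μ, ν)` need not be related to those for `(ν, μ)`; anti-symmetry is
  -- imposed by averaging.
  estimate x := of fun μ ν =>
    (c μ ν * roundAverage hm (D μ ν) (k μ ν) x - c ν μ * roundAverage hm (D ν μ) (k ν μ) x) / 2
  antisymm x := by
    ext μ ν
    simp only [transpose_apply, of_apply, Matrix.neg_apply]
    ring

/-- Since `A` is anti-symmetric too, the error of an entry is half a difference of two errors of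
size at most `t`. On the diagonal `c` vanishes and there is none. -/
lemma roundEstimator_error_le {m N : ℕ} (hm : 0 < m)
    (M : Fin m → Measurement n (Fintype.card (Basis n))) {D : Label n → Label n → Fin m}
    {k : Label n → Label n → Fin n} {c : Label n → Label n → ℝ} {A : Matrix (Label n) (Label n) ℝ}
    (hA : Aᵀ = -A) {z : Fin m → Fin n → ℝ} (hc : ∀ μ ν, |c μ ν| ≤ if μ = ν then 0 else 1)
    (hz : ∀ μ ν, A μ ν = c μ ν * z (D μ ν) (k μ ν)) {t : ℝ}
    {x : Fin N → Fin (Fintype.card (Basis n))}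
    (hx : ∀ d k, |roundAverage hm d k x - z d k| ≤ t) (μ ν : Label n) :
    |((roundEstimator N hm M D k c).estimate x - A) μ ν| ≤ if μ = ν then 0 else t := by
  have hdiff : ((roundEstimator N hm M D k c).estimate x - A) μ ν =
      (c μ ν * (roundAverage hm (D μ ν) (k μ ν) x - z (D μ ν) (k μ ν)) -
        c ν μ * (roundAverage hm (D ν μ) (k ν μ) x - z (D ν μ) (k ν μ))) / 2 := by
    have h1 : ((roundEstimator N hm M D k c).estimate x) μ ν =
      (c μ ν * roundAverage hm (D μ ν) (k μ ν) x -
        c ν μ * roundAverage hm (D ν μ) (k ν μ) x) / 2 := rfl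
    have h2 := hz μ ν
    have h3 := hz ν μ
    rw [← transpose_apply A, hA, Matrix.neg_apply] at h3
    rw [Matrix.sub_apply, h1]
    linarith
  have hterm : ∀ μ ν, |c μ ν * (roundAverage hm (D μ ν) (k μ ν) x - z (D μ ν) (k μ ν))| ≤
      (if μ = ν then 0 else 1) * t := fun μ ν => by
    rw [abs_mul]
    exact mul_le_mul (hc μ ν) (hx _ _) (abs_nonneg _) ((abs_nonneg _).trans (hc μ ν))
  have h1 := hterm μ ν
  have h2 := hterm ν μ
  rw [hdiff, abs_div, abs_two, div_le_iff₀ two_pos]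
  refine (abs_sub _ _).trans ?_
  by_cases h : μ = ν
  · subst h
    simp only [if_true] at h1 ⊢
    linarith
  · rw [if_neg h] at h1 ⊢
    rw [if_neg (Ne.symm h)] at h2
    linarith

lemma productProb_roundAverage_le {m N s : ℕ} (hm : 0 < m)
    {M : Fin m → Measurement n (Fintype.card (Basis n))} {ρ : Op n} (hρ : IsState ρ)
    {z : Fin m → Fin n → ℝ} (hz : ∀ d k, ∑ a, (M d).outcomeProb ρ a * outcomeSign k a = z d k)
    (hs : 0 < s) (hNs : s ≤ N / m) {t : ℝ} (ht : 0 ≤ t) (d : Fin m) (k : Fin n) :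
    productProb (fun i : Fin N => (M (copyRound hm i)).outcomeProb ρ)
      {x | t < |roundAverage hm d k x - z d k|} ≤ 2 * Real.exp (-(s * t ^ 2 / 2)) := by
  have hcard := hNs.trans (div_le_card_copiesOf (N := N) hm d)
  have hq0 : ∀ (i : Fin N) a, 0 ≤ (M (copyRound hm i)).outcomeProb ρ a :=
    fun i a => (M _).outcomeProb_nonneg hρ a
  have hq1 : ∀ i : Fin N, ∑ a, (M (copyRound hm i)).outcomeProb ρ a = 1 :=
    fun i => (M _).sum_outcomeProb hρ
  have hf : ∀ a, outcomeSign k a ∈ Set.Icc (-1 : ℝ) 1 := fun a => bitSign_mem_Icc _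
  have hmean : ∀ i ∈ copiesOf (N := N) hm d,
      ∑ a, (M (copyRound hm i)).outcomeProb ρ a * outcomeSign k a = z d k := fun i hi => by
    rw [(Finset.mem_filter.mp hi).2, hz]
  refine (productProb_lt_abs_average_sub_le hq0 hq1 (hs.trans_le hcard) hf hmean ht).trans ?_
  · have : (s : ℝ) ≤ (copiesOf (N := N) hm d).card := Nat.cast_le.mpr hcard
    gcongr

/-- There is an estimator of the correlation matrix with exponentially small error probability. -/
lemma exists_correlationEstimator (hn : 1 ≤ n) {N s : ℕ} (hs : 0 < s)
    (hNs : s ≤ N / (2 * n - 1)) :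
    ∃ alg : CorrelationEstimator n N (Fintype.card (Basis n)), ∀ (ρ : Op n), IsState ρ →
      ∀ t : ℝ, 0 ≤ t → 1 - 4 * n ^ 2 * Real.exp (-(s * t ^ 2 / 2)) ≤
        alg.prob ρ {x | ∀ μ ν, |(alg.estimate x - realCorrelation ρ) μ ν| ≤
          if μ = ν then 0 else t} := by
  have hm : 0 < 2 * n - 1 := by omega
  obtain ⟨π, hπ⟩ := exists_matchings hn
  choose M hM using fun d => exists_measurement (π d)
  -- The sign `c` records the order in which the matching lists the pair. On the diagonal `c = 0`,
  -- and the round and qubit are arbitrary.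
  have hcov : ∀ μ ν : Label n, ∃ (d : Fin (2 * n - 1)) (k : Fin n) (c : ℝ),
      |c| ≤ (if μ = ν then 0 else 1) ∧ ∀ ρ : Op n, realCorrelation ρ μ ν =
        c * realCorrelation ρ (π d (k, 0)) (π d (k, 1)) := fun μ ν => by
    by_cases h : μ = ν
    · refine ⟨⟨0, hm⟩, ⟨0, hn⟩, 0, by simp [h], fun ρ => ?_⟩
      rw [h, realCorrelation_self, zero_mul]
    · obtain ⟨d, k, ⟨h1, h2⟩ | ⟨h1, h2⟩⟩ := hπ μ ν h
      · exact ⟨d, k, 1, by simp [h], fun ρ => by rw [h1, h2, one_mul]⟩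
      · exact ⟨d, k, -1, by simp [h], fun ρ => by rw [h1, h2, realCorrelation_swap]; ring⟩
  choose D k c hc hDk using hcov
  refine ⟨roundEstimator N hm M D k c, fun ρ hρ t ht => ?_⟩
  set q : Fin N → Fin (Fintype.card (Basis n)) → ℝ := fun i =>
    (M (copyRound hm i)).outcomeProb ρ
  have hq0 : ∀ i a, 0 ≤ q i a := fun i a => (M _).outcomeProb_nonneg hρ a
  have hq1 : ∀ i, ∑ a, q i a = 1 := fun i => (M _).sum_outcomeProb hρ
  set bad : Fin (2 * n - 1) × Fin n → Set (Fin N → Fin (Fintype.card (Basis n))) := fun p =>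
    {x | t < |roundAverage hm p.1 p.2 x - realCorrelation ρ (π p.1 (p.2, 0)) (π p.1 (p.2, 1))|}
  have hgood : (⋃ p, bad p)ᶜ ⊆ {x | ∀ μ ν, |((roundEstimator N hm M D k c).estimate x -
      realCorrelation ρ) μ ν| ≤ if μ = ν then 0 else t} := fun x hx =>
    roundEstimator_error_le hm M (realCorrelation_transpose ρ)
      (z := fun d k => realCorrelation ρ (π d (k, 0)) (π d (k, 1))) hc (fun μ ν => hDk μ ν ρ)
      fun d k => not_lt.mp fun h => hx (Set.mem_iUnion.mpr ⟨(d, k), h⟩)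
  have h1 := productProb_mono hq0 hgood
  have h2 := productProb_add_compl q (⋃ p, bad p)
  rw [productProb_univ hq1] at h2
  -- Union bound over `(2n - 1) n ≤ 2n²` pairs, each with the two-sided Hoeffding prefactor `2`.
  have h3 : productProb q (⋃ p, bad p) ≤ 4 * n ^ 2 * Real.exp (-(s * t ^ 2 / 2)) := by
    calc productProb q (⋃ p, bad p) ≤ ∑ p, productProb q (bad p) := productProb_iUnion_le hq0 bad
      _ ≤ ∑ _p : Fin (2 * n - 1) × Fin n, 2 * Real.exp (-(s * t ^ 2 / 2)) :=
          Finset.sum_le_sum fun p _ => productProb_roundAverage_le hm hρ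
            (z := fun d k => realCorrelation ρ (π d (k, 0)) (π d (k, 1)))
            (fun d k => hM d ρ k) hs hNs ht p.1 p.2
      _ = ((2 * n - 1) * n : ℕ) * (2 * Real.exp (-(s * t ^ 2 / 2))) := by
          rw [Finset.sum_const, Finset.card_univ, Fintype.card_prod, Fintype.card_fin,
            Fintype.card_fin, nsmul_eq_mul]
      _ ≤ ((2 * n) * n : ℕ) * (2 * Real.exp (-(s * t ^ 2 / 2))) := by
          gcongr
          omega
      _ = _ := by
          push_cast
          ring
  change _ ≤ productProb q _
  linarith

/-- The argument is at least `4 > e`. This slack pays for copies lost to rounding in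
`le_numCopies_div`. -/
lemma one_le_log_four_mul_sq_div (hn : 1 ≤ n) {δ : ℝ} (hδ : δ ∈ Set.Ioc (0 : ℝ) 1) :
    1 ≤ Real.log (4 * (n : ℝ) ^ 2 / δ) := by
  have hn' : (1 : ℝ) ≤ n := Nat.one_le_cast.mpr hn
  obtain ⟨hδ0, hδ1⟩ := hδ
  have h4 : 4 ≤ 4 * (n : ℝ) ^ 2 / δ := by
    rw [le_div_iff₀ hδ0]
    nlinarith
  rw [Real.le_log_iff_exp_le (by linarith)]
  linarith [Real.exp_one_lt_d9]

/-- Division into `2n - 1` rounds wastes at most `2n - 2` copies. The loss is absorbed because `8n³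
- 2n (2n - 1)² = 2n (4n - 1)`, while `εstat ≤ 1` and the logarithm is at least one. -/
lemma le_numCopies_div (hn : 1 ≤ n) {εstat δ : ℝ} (hδ : δ ∈ Set.Ioc (0 : ℝ) 1)
    (h0 : 0 < εstat) (h1 : εstat ≤ 1) :
    2 * n * (2 * n - 1) * Real.log (4 * (n : ℝ) ^ 2 / δ) ≤
      (numCopies n εstat δ / (2 * n - 1) : ℕ) * εstat ^ 2 := by
  have hn' : (1 : ℝ) ≤ n := Nat.one_le_cast.mpr hn
  set L := Real.log (4 * (n : ℝ) ^ 2 / δ) with hL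
  have hL1 : 1 ≤ L := one_le_log_four_mul_sq_div hn hδ
  set N := numCopies n εstat δ with hN
  have hN1 : 8 * ((n : ℝ) ^ 3 / εstat ^ 2) * L ≤ N := Nat.le_ceil _
  have hm : 0 < 2 * n - 1 := by omega
  have hcast : ((2 * n - 1 : ℕ) : ℝ) = 2 * n - 1 := by
    rw [Nat.cast_sub (by omega)]
    push_cast
    ring
  have hdiv : (N : ℝ) + 1 ≤ (2 * n - 1) * (N / (2 * n - 1) : ℕ) + (2 * n - 1) := by
    have h2 : N + 1 ≤ (2 * n - 1) * (N / (2 * n - 1)) + (2 * n - 1) := by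
      have := Nat.div_add_mod N (2 * n - 1)
      have := Nat.mod_lt N hm
      omega
    have h3 : ((N + 1 : ℕ) : ℝ) ≤ ((2 * n - 1) * (N / (2 * n - 1)) + (2 * n - 1) : ℕ) :=
      Nat.cast_le.mpr h2
    rw [Nat.cast_add, Nat.cast_add, Nat.cast_mul, hcast, Nat.cast_one] at h3
    exact h3
  have hsq : 0 < εstat ^ 2 := by positivity
  have hsq1 : εstat ^ 2 ≤ 1 := pow_le_one₀ h0.le h1
  have h4 : 8 * (n : ℝ) ^ 3 * L ≤ N * εstat ^ 2 := by
    have := mul_le_mul_of_nonneg_right hN1 hsq.le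
    calc 8 * (n : ℝ) ^ 3 * L = 8 * ((n : ℝ) ^ 3 / εstat ^ 2) * L * εstat ^ 2 := by
          field_simp
      _ ≤ _ := this
  have h5 : (0 : ℝ) < 2 * n - 1 := by linarith
  refine le_of_mul_le_mul_left ?_ h5
  set r : ℝ := ((N / (2 * n - 1) : ℕ) : ℝ)
  have h6 := mul_le_mul_of_nonneg_right hdiv hsq.le
  have h7 : (2 * (n : ℝ) - 2) * εstat ^ 2 ≤ 2 * n * (4 * n - 1) * L := by
    calc (2 * (n : ℝ) - 2) * εstat ^ 2 ≤ (2 * n - 2) * 1 :=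
          mul_le_mul_of_nonneg_left hsq1 (by linarith)
      _ ≤ 2 * n * (4 * n - 1) * 1 := by nlinarith
      _ ≤ _ := mul_le_mul_of_nonneg_left hL1 (by nlinarith)
  nlinarith

end Estimator

/-! ### Operator-norm accuracy and the test -/

noncomputable section Testing

variable {n : ℕ}

/-- The `2n (2n - 1)` off-diagonal entries bound the squared Frobenius norm of the error, and
anti-symmetry halves this to `n (2n - 1) t²`. -/
lemma opNorm_sub_correlationMatrix_le {ρ : Op n} (hρ : ρ.IsHermitian)
    {G : Matrix (Label n) (Label n) ℝ} (hG : Gᵀ = -G) {ε t : ℝ} (hε : 0 ≤ ε)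
    (ht : n * (2 * n - 1) * t ^ 2 ≤ ε ^ 2)
    (h : ∀ μ ν, |(G - realCorrelation ρ) μ ν| ≤ if μ = ν then 0 else t) :
    opNorm (G.map (fun r : ℝ => (r : ℂ)) - correlationMatrix ρ) ≤ ε := by
  rw [map_sub_correlationMatrix hρ, opNorm_map_ofReal_le_iff _ hε]
  intro v
  have hE : (G - realCorrelation ρ)ᵀ = -(G - realCorrelation ρ) := by
    rw [transpose_sub, hG, realCorrelation_transpose]
    abel
  have h1 := antisymm_mulVec_sq_le hE v
  have h2 : ∑ μ, ∑ ν, (G - realCorrelation ρ) μ ν ^ 2 ≤ 2 * (n * (2 * n - 1) * t ^ 2) := by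
    calc ∑ μ, ∑ ν, (G - realCorrelation ρ) μ ν ^ 2
        ≤ ∑ μ : Label n, ∑ ν : Label n, (t ^ 2 - if μ = ν then t ^ 2 else 0) := by
          refine Finset.sum_le_sum fun μ _ => Finset.sum_le_sum fun ν _ => ?_
          have h3 := pow_le_pow_left₀ (abs_nonneg _) (h μ ν) 2
          rw [sq_abs] at h3
          refine h3.trans_eq ?_
          split_ifs <;> simp
      _ = _ := by
          simp only [Finset.sum_sub_distrib, Finset.sum_ite_eq, Finset.mem_univ, if_true,
            Finset.sum_const, Finset.card_univ, Fintype.card_prod, Fintype.card_fin, nsmul_eq_mul]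
          push_cast
          ring
  have h4 := mul_le_mul_of_nonneg_right (h2.trans (mul_le_mul_of_nonneg_left ht two_pos.le))
    (dotProduct_self_nonneg v)
  linarith

/-- The correlation matrix can be estimated from single-copy measurements. -/
lemma exists_accurate_correlationEstimator (hn : 1 ≤ n) {εstat δ : ℝ}
    (hδ : δ ∈ Set.Ioc (0 : ℝ) 1) (h0 : 0 < εstat) (h1 : εstat ≤ 1) :
    ∃ alg : CorrelationEstimator n (numCopies n εstat δ) (Fintype.card (Basis n)),
      ∀ ρ : Op n, IsState ρ → 1 - δ ≤ alg.prob ρ {x | opNorm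
        ((alg.estimate x).map (fun r : ℝ => (r : ℂ)) - correlationMatrix ρ) ≤ εstat} := by
  have hn' : (1 : ℝ) ≤ n := Nat.one_le_cast.mpr hn
  have hL1 := one_le_log_four_mul_sq_div hn hδ
  have hs := le_numCopies_div hn hδ h0 h1
  set L := Real.log (4 * (n : ℝ) ^ 2 / δ) with hL
  set s := numCopies n εstat δ / (2 * n - 1) with hs'
  have hc : 0 < (n : ℝ) * (2 * n - 1) := mul_pos (by linarith) (by linarith)
  have hs0 : 0 < s := by
    rw [Nat.pos_iff_ne_zero]
    intro h
    rw [h, Nat.cast_zero, zero_mul] at hs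
    nlinarith
  obtain ⟨alg, halg⟩ := exists_correlationEstimator hn hs0 hs'.le
  refine ⟨alg, fun ρ hρ => ?_⟩
  -- The largest entrywise error that the Frobenius bound can convert into operator-norm error
  -- `εstat`.
  set t := √(εstat ^ 2 / (n * (2 * n - 1))) with ht
  have ht2 : t ^ 2 = εstat ^ 2 / (n * (2 * n - 1)) := Real.sq_sqrt (by positivity)
  have hexp : 4 * (n : ℝ) ^ 2 * Real.exp (-(s * t ^ 2 / 2)) ≤ δ := by
    have h2 : L ≤ s * t ^ 2 / 2 := by
      rw [ht2, le_div_iff₀ two_pos, ← mul_div_assoc, le_div_iff₀ hc]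
      linarith
    have hpos : 0 < 4 * (n : ℝ) ^ 2 / δ := div_pos (by positivity) hδ.1
    calc 4 * (n : ℝ) ^ 2 * Real.exp (-(s * t ^ 2 / 2))
        ≤ 4 * (n : ℝ) ^ 2 * Real.exp (-L) := by gcongr
      _ = δ := by
          rw [Real.exp_neg, hL, Real.exp_log hpos]
          field_simp
  have h2 := halg ρ hρ t (Real.sqrt_nonneg _)
  refine (by linarith : 1 - δ ≤ 1 - 4 * (n : ℝ) ^ 2 * Real.exp (-(s * t ^ 2 / 2))).trans
    (h2.trans (productProb_mono (fun i a => (alg.measurement i).outcomeProb_nonneg hρ a) ?_))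
  intro x hx
  refine opNorm_sub_correlationMatrix_le hρ.1.1 (alg.antisymm x) h0.le ?_ hx
  rw [ht2, mul_div_cancel₀ _ hc.ne']

end Testing

end FreeFermion

theorem mainTheorem9 (n : ℕ) (hn : 1 ≤ n) (εA εB δ εstat : ℝ)
    (hA : εA ∈ Set.Ioo (0 : ℝ) 1) (hB : εB ∈ Set.Ioo (0 : ℝ) 1)
    (hAB : 2 * Real.sqrt ((n : ℝ) * εA) < εB)
    (hδ : δ ∈ Set.Ioc (0 : ℝ) 1)
    (hstat_pos : 0 < εstat)
    (hstat : εstat < 1 / 2 * (εB ^ 2 / (2 * (n : ℝ)) - 2 * εA)) :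
    ∃ (K : ℕ) (alg : FreeFermion.CorrelationEstimator n (FreeFermion.numCopies n εstat δ) K),
      (∀ ρ : FreeFermion.Op n, FreeFermion.IsState ρ →
        1 - δ ≤ alg.prob ρ {x | FreeFermion.opNorm
          ((alg.estimate x).map (fun r : ℝ => (r : ℂ)) - FreeFermion.correlationMatrix ρ)
            ≤ εstat}) ∧
      ∀ (𝒢 : Set (FreeFermion.Op n)) (ρ : FreeFermion.Op n), FreeFermion.IsState ρ →
        (FreeFermion.IsPure ρ ∧ (𝒢 = FreeFermion.freeMixed n ∨ 𝒢 = FreeFermion.freePure n)) ∨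
          𝒢 = FreeFermion.freePure n →
        (FreeFermion.CaseA 𝒢 εA ρ →
          1 - δ ≤ alg.prob ρ {x | alg.verdict (FreeFermion.threshold n εA εB) x
            = FreeFermion.Verdict.A}) ∧
        (FreeFermion.CaseB 𝒢 εB ρ →
          1 - δ ≤ alg.prob ρ {x | alg.verdict (FreeFermion.threshold n εA εB) x
            = FreeFermion.Verdict.B}) := by
  have hn' : (1 : ℝ) ≤ n := Nat.one_le_cast.mpr hn
  obtain ⟨hA0, hA1⟩ := hA
  obtain ⟨hB0, hB1⟩ := hB
  set b := εB ^ 2 / (2 * (n : ℝ)) with hb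
  have hbn : b * (2 * n) = εB ^ 2 := div_mul_cancel₀ _ (by positivity)
  have hB2 : εB ^ 2 < 1 := by nlinarith
  have hb1 : b ≤ 1 / 2 := by nlinarith
  have hT : FreeFermion.threshold n εA εB = 1 / 2 * (b + 2 * εA) := rfl
  obtain ⟨alg, halg⟩ := FreeFermion.exists_accurate_correlationEstimator hn hδ hstat_pos
    (by linarith)
  refine ⟨_, alg, halg, fun 𝒢 ρ hρ h𝒢 => ⟨fun hcase => ?_, fun hcase => ?_⟩⟩
  · refine (halg ρ hρ).trans (FreeFermion.productProb_mono
      (fun i a => (alg.measurement i).outcomeProb_nonneg hρ a) fun x hx => ?_)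
    obtain ⟨σ, hσ, hle⟩ := hcase
    have hmix : σ ∈ FreeFermion.freeMixed n ∧ (FreeFermion.IsPure ρ ∨ FreeFermion.IsPure σ) := by
      rcases h𝒢 with ⟨hp, rfl | rfl⟩ | rfl
      · exact ⟨hσ, Or.inl hp⟩
      · exact ⟨hσ.1, Or.inl hp⟩
      · exact ⟨hσ.1, Or.inr hσ.2⟩
    exact if_pos (FreeFermion.one_sub_le_minSingularValue hn hρ hmix.1 hmix.2 hle hstat_pos.le hx
      (by rw [hT]; linarith) (by rw [hT]; linarith))
  · refine (halg ρ hρ).trans (FreeFermion.productProb_mono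
      (fun i a => (alg.measurement i).outcomeProb_nonneg hρ a) fun x hx => ?_)
    refine if_neg fun hle => ?_
    -- An output "A" on an accurate estimate would give a free-fermionic `σ` with squared distance
    -- at most `2n (εT + εstat) < 2n b = εB²`, contradicting Case B.
    have hts : FreeFermion.threshold n εA εB + εstat < b := by rw [hT]; linarith
    obtain ⟨σ, hσ, hσρ⟩ := FreeFermion.exists_mem_freePure_traceNorm_sub_sq_le hn hρ hstat_pos.le
      hx hle (by linarith) (by nlinarith)
    have hσ𝒢 : σ ∈ 𝒢 := by
      rcases h𝒢 with ⟨-, rfl | rfl⟩ | rfl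
      · exact hσ.1
      · exact hσ
      · exact hσ
    have h1 := pow_le_pow_left₀ hB0.le (hcase σ hσ𝒢).le 2
    nlinarith
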